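/- Let $(a_n)_{n\ge 0}$ be a sequence of positive integers with $a_n\ge 2$ for all $n\ge 1$ and $\sum_{n=0}^\infty \frac{n}{a_n}<\infty$. Let $B$ be the Bratteli diagram with levels $V_n=\{0,1,\dots,n\}$, $n\ge 0$, and the following edges from $V_n$ to $V_{n+1}$. For $n=0$ there are $a_0$ edges from $0\in V_0$ to each of the two vertices of $V_1$. For $n\ge 1$, a vertex $w\in V_{n+1}$ with $w\le n$ receives $a_n$ edges from $w\in V_n$ and one edge from every other $u\in V_n$, and the vertex $n+1\in V_{n+1}$ receives $a_n-1$ edges from $n\in V_n$, two edges from $n-1\in V_n$ and one edge from each $u\in\{0,\dots,n-2\}$. Order the edges into each vertex from left to right, i.e. by increasing source. Let $X_B$ be the space of infinite paths of $B$ starting at the vertex of $V_0$, with the topology generated by cylinder sets. Then the following hold. 1. The order is consecutive: if $e\le f\le g$ are edges with the same target and $e,g$ have the same source, then $f$ has this source too. There are exactly one infinite minimal path and exactly one infinite maximal path. The number of finite paths from $V_0$ to $v$ is $h_n=\prod_{i=0}^{n-1}(a_i+i)$ for every $n$ and every $v\in V_n$ (so all towers of level $n$ have the height $h_n$). 2.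 There is exactly one homeomorphism $\varphi_B$ of $X_B$ that extends the Vershik map (defined on non-maximal paths: replace the first non-maximal edge by its successor and the segment before it by the minimal path). It is minimal and has topological entropy zero. 3. Let $\theta_n: V_n\to V_{n-1}^+$, $n\ge 2$, be the substitutions read on $B$ ($\theta_n(v)$ is the word of the sources of the edges into $v$, in increasing order), and for $v\in V_1$ let $\theta_1(v)$ be the word of the edges into $v$, in increasing order, over the alphabet $E_1$ of edges from $V_0$ to $V_1$ (if $a_0=1$, then $E_1$ can be identified with $V_1$, and $\theta_1$ with the identity). For every choice of letters $c_0\in E_1$ and $c_n\in V_n$ ($n\ge 1$), the $S$-adic subshift of all sequences in $E_1^{\mathbb Z}$ whose finite subwords all occur in $\theta_1\cdots\theta_n(c_n)$ for some $n\ge 0$ (for $n=0$ this is the word $c_0$) is a Toeplitz system, that is, the orbit closure of a regularly recurrent non-periodic sequence, and it is topologically conjugate to $(X_B,\varphi_B)$. 4. $\varphi_B$ has countably infinitely many ergodic invariant Borel probability measures. They are exactly the pairwise different measures $\mu_j$, $j\in\{0,1,2,\dots\}\cup\{\infty\}$, where $\mu_j$ is the only $\varphi_B$-invariant Borel probability measure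 that gives measure one to the set of paths tail equivalent to a path of the odometer through the vertices $\min(j,n)\in V_n$, $n\ge 0$. 5. For every $\varphi_B$-invariant Borel probability measure $\nu$ on $X_B$ (ergodic or not), $(h_n)_n$ is a rigidity sequence: $h_n\to\infty$ and $\nu(\varphi_B^{-h_n}(A)\,\triangle\,A)\to 0$ for every Borel set $A\subset X_B$. -/

import Mathlib

open Set Filter Topology MeasureTheory
open scoped symmDiff

/-- An ordered Bratteli diagram. `E n` is the set of edges between the levels `V n` and `V (n + 1)`.
The partial order on `E n` restricts to a linear order on each set of edges with a common target,
and edges with different targets are incomparable. -/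
structure OrderedBratteliDiagram where
  V : ℕ → Type
  E : ℕ → Type
  finite_V : ∀ n, Finite (V n)
  finite_E : ∀ n, Finite (E n)
  src : ∀ {n}, E n → V n
  tgt : ∀ {n}, E n → V (n + 1)
  root : V 0
  eq_root : ∀ v : V 0, v = root
  src_surjective : ∀ n, Function.Surjective (src (n := n))
  tgt_surjective : ∀ n, Function.Surjective (tgt (n := n))
  order : ∀ n, PartialOrder (E n)
  comparable_iff : ∀ n (e f : E n), (e ≤ f ∨ f ≤ e) ↔ tgt e = tgt f

namespace OrderedBratteliDiagram

variable (B : OrderedBratteliDiagram)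

instance (n : ℕ) : Finite (B.V n) := B.finite_V n

instance (n : ℕ) : Finite (B.E n) := B.finite_E n

instance (n : ℕ) : PartialOrder (B.E n) := B.order n

/-- The finite edge sets carry the discrete uniformity (hence the discrete topology). -/
instance (n : ℕ) : UniformSpace (B.E n) := ⊥

/-- The order is consecutive: between two edges with the same source there are only edges
with that source. -/
def IsConsecutive : Prop :=
  ∀ (n : ℕ) (e f g : B.E n), e ≤ f → f ≤ g → B.src e = B.src g → B.src f = B.src e

/-- The space of infinite paths starting at the root. -/
def PathSpace : Type :=
  {x : (n : ℕ) → B.E n // ∀ n, B.tgt (x n) = B.src (x (n + 1))}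

/-- The topology (and the uniformity) of the path space is induced from the product of the discrete
edge sets; it is generated by the cylinder sets. -/
instance : UniformSpace B.PathSpace :=
  inferInstanceAs (UniformSpace {x : (n : ℕ) → B.E n // ∀ n, B.tgt (x n) = B.src (x (n + 1))})

instance : MeasurableSpace B.PathSpace := borel B.PathSpace

instance : BorelSpace B.PathSpace := ⟨rfl⟩

/-- The infinite paths all of whose edges are maximal among the edges with the same target. -/
def maxPaths : Set B.PathSpace := {x | ∀ n, IsMax (x.1 n)}

/-- The infinite paths all of whose edges are minimal among the edges with the same target. -/
def minPaths : Set B.PathSpace := {x | ∀ n, IsMin (x.1 n)}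

/-- `y` is the image of the path `x` under the Vershik rule: the first non-maximal edge `x m` of `x`
is replaced by its successor, the initial segment before it by the minimal path, and the rest of the
path is kept. -/
def IsSuccessor (x y : B.PathSpace) : Prop :=
  ∃ m : ℕ, (∀ i < m, IsMax (x.1 i)) ∧ ¬ IsMax (x.1 m) ∧ x.1 m ⋖ y.1 m ∧
    (∀ i < m, IsMin (y.1 i)) ∧ ∀ i, m < i → y.1 i = x.1 i

/-- A Vershik map: a homeomorphism of the path space that extends the Vershik rule. -/
def IsVershikMap (φ : B.PathSpace ≃ₜ B.PathSpace) : Prop :=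
  ∀ x, x ∉ B.maxPaths → B.IsSuccessor x (φ x)

/-- The finite paths from the root to a vertex of level `n`. -/
inductive PathTo : (n : ℕ) → B.V n → Type
  | nil (v : B.V 0) : PathTo 0 v
  | cons {n : ℕ} (e : B.E n) (p : PathTo n (B.src e)) : PathTo (n + 1) (B.tgt e)

/-- The height of the tower of the vertex `v`: the number of finite paths from the root to `v`. -/
noncomputable def height (n : ℕ) (v : B.V n) : ℕ := Nat.card (B.PathTo n v)

/-- The paths that are tail equivalent to a path of the odometer through the vertices `W n`. -/
def tailPaths (W : (n : ℕ) → B.V n) : Set B.PathSpace :=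
  {x | ∃ y : B.PathSpace, (∀ n, B.src (y.1 n) = W n) ∧ ∃ N, ∀ i, N ≤ i → x.1 i = y.1 i}

instance (n : ℕ) (v : B.V (n + 1)) :
    Std.Total (fun e f : {e : B.E n // B.tgt e = v} => e ≤ f) :=
  ⟨fun e f => (B.comparable_iff n e.1 f.1).2 (e.2.trans f.2.symm)⟩

open Classical in
/-- The edges with target `v`, listed in increasing order. -/
noncomputable def incoming {n : ℕ} (v : B.V (n + 1)) : List (B.E n) :=
  letI := Fintype.ofFinite {e : B.E n // B.tgt e = v}
  ((Finset.univ : Finset {e : B.E n // B.tgt e = v}).sort (fun e f => e ≤ f)).map Subtype.val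

/-- The alphabets of the substitutions read on the diagram: the vertex sets `V (n + 1)`,
and below them the set `E 0` of first edges (if there is just one edge from the root to each vertex
of level one, then `E 0` is the same as `V 1`). -/
def Alphabet : ℕ → Type
  | 0 => B.E 0
  | n + 1 => B.V (n + 1)

/-- The alphabets are discrete. -/
instance (n : ℕ) : TopologicalSpace (B.Alphabet n) := ⊥

/-- The substitutions read on the diagram: a vertex of level `n + 2` is sent to the word formed by
the sources of its incoming edges, in increasing order. A vertex of level one is sent to the word
formed by its incoming edges. -/
noncomputable def substitution : (n : ℕ) → B.Alphabet (n + 1) → List (B.Alphabet n)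
  | 0 => fun v => B.incoming (n := 0) v
  | n + 1 => fun v => (B.incoming (n := n + 1) v).map B.src

end OrderedBratteliDiagram

/-! ### Symbolic systems -/

/-- The left shift. -/
def leftShift {A : Type} (x : ℤ → A) : ℤ → A := fun i => x (i + 1)

/-- The composition `θ 0 ∘ ⋯ ∘ θ (n - 1)`, applied to a letter of the `n`-th alphabet. -/
def composedWord {A : ℕ → Type} (θ : (n : ℕ) → A (n + 1) → List (A n)) :
    (n : ℕ) → A n → List (A 0)
  | 0 => fun a => [a]
  | n + 1 => fun a => (θ n a).flatMap (composedWord θ n)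

/-- The `S`-adic subshift defined by substitutions `θ` and letters `c`: the bi-infinite sequences all
of whose finite subwords occur in some `θ 0 (θ 1 (⋯ (θ (n - 1) (c n))))`. -/
def sAdicSubshift {A : ℕ → Type} (θ : (n : ℕ) → A (n + 1) → List (A n)) (c : (n : ℕ) → A n) :
    Set (ℤ → A 0) :=
  {x | ∀ (i : ℤ) (k : ℕ), ∃ n,
    List.ofFn (fun j : Fin k => x (i + (j : ℕ))) <:+: composedWord θ n (c n)}

/-- `x` is regularly recurrent: for every neighbourhood `U` of `x`, the times at which `x` visits `U`
contain all multiples of some positive integer. -/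
def IsRegularlyRecurrent {X : Type} [TopologicalSpace X] (T : X → X) (x : X) : Prop :=
  ∀ U ∈ 𝓝 x, ∃ d : ℕ, 0 < d ∧ ∀ k : ℕ, T^[k * d] x ∈ U

/-- `Y` is a Toeplitz system: the orbit closure of a regularly recurrent, non-periodic sequence. -/
def IsToeplitzSystem {A : Type} [TopologicalSpace A] (Y : Set (ℤ → A)) : Prop :=
  ∃ ω : ℤ → A, IsRegularlyRecurrent leftShift ω ∧ ω ∉ Function.periodicPts (leftShift (A := A)) ∧
    Y = closure (range fun (k : ℤ) (i : ℤ) => ω (i + k))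

/-- `t` is a rigidity sequence for the system `(X, T, μ)`. -/
def IsRigidAlong {X : Type} [MeasurableSpace X] (T : X → X) (μ : Measure X) (t : ℕ → ℕ) : Prop :=
  Tendsto t atTop atTop ∧
    ∀ A : Set X, MeasurableSet A → Tendsto (fun n => μ ((T^[t n] ⁻¹' A) ∆ A)) atTop (𝓝 0)

/-! ### The diagrams with countably many ergodic measures -/

/-- The number of edges between `w ∈ V (n + 1) = {0, …, n + 1}` and `u ∈ V n = {0, …, n}`. -/
def edgeCount (a : ℕ → ℕ) (n w u : ℕ) : ℕ :=
  if w ≤ n then (if u = w then a n else 1)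
  else if n = 0 then a n
  else if u = n then a n - 1
  else if u + 1 = n then 2
  else 1

/-- The edges between `V n` and `V (n + 1)`: triples (target, source, number of the edge). Edges with
the same target are ordered from left to right, that is, lexicographically by source and number;
edges with different targets are incomparable. -/
abbrev CountableEdge (a : ℕ → ℕ) (n : ℕ) : Type :=
  Σ w : Fin (n + 2), Σₗ u : Fin (n + 1), Fin (edgeCount a n w u)

/-- The diagram with `V n = {0, …, n}`, the incidence numbers `edgeCount a` and the left-to-right
order. -/
def countableDiagram (a : ℕ → ℕ) (ha : ∀ n, 0 < a n) : OrderedBratteliDiagram where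
  V n := Fin (n + 1)
  E n := CountableEdge a n
  finite_V n := inferInstance
  finite_E n := by
    have (w : Fin (n + 2)) : Finite (Σₗ u : Fin (n + 1), Fin (edgeCount a n w u)) :=
      inferInstanceAs (Finite (Σ u : Fin (n + 1), Fin (edgeCount a n w u)))
    exact inferInstanceAs (Finite (Σ w : Fin (n + 2), _))
  src e := (ofLex e.2).1
  tgt e := e.1
  root := (0 : Fin 1)
  eq_root v := Subsingleton.elim (α := Fin 1) _ _
  src_surjective n u := by
    refine ⟨⟨u.castSucc, toLex ⟨u, ⟨0, ?_⟩⟩⟩, rfl⟩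
    have hu : (u : ℕ) ≤ n := by omega
    simpa [edgeCount, hu] using ha n
  tgt_surjective n w := by
    by_cases hw : (w : ℕ) ≤ n
    · refine ⟨⟨w, toLex ⟨⟨w, by omega⟩, ⟨0, ?_⟩⟩⟩, rfl⟩
      simpa [edgeCount, hw] using ha n
    · refine ⟨⟨w, toLex ⟨⟨n - 1, by omega⟩, ⟨0, ?_⟩⟩⟩, rfl⟩
      have h0 := ha n
      simp only [edgeCount, hw, if_false]
      split_ifs <;> omega
  order n := inferInstance
  comparable_iff n e f := by
    obtain ⟨w, p⟩ := e
    obtain ⟨w', q⟩ := f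
    constructor
    · rintro (h | h)
      · obtain ⟨h, -⟩ := Sigma.le_def.1 h
        exact h
      · obtain ⟨h, -⟩ := Sigma.le_def.1 h
        exact h.symm
    · intro h
      change w = w' at h
      subst h
      exact (le_total p q).imp (fun h => Sigma.mk_le_mk_iff.2 h) (fun h => Sigma.mk_le_mk_iff.2 h)

/-- The vertex sequences `(0, 1, …, j, j, j, …)` for finite `j`, and `(0, 1, 2, …)` for `j = ⊤`. -/
noncomputable def odometerVertex (j : ℕ∞) (n : ℕ) : Fin (n + 1) :=
  ⟨(min j (n : ℕ∞)).toNat, Nat.lt_succ_of_le (ENat.toNat_le_of_le_natCast (min_le_right _ _))⟩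

/-!
A path is encoded by its vertices `vert x n` and by the ranks `rk x n` of its edges among the edges
with the same target; the only relation is `vert x n = sourceAt a n (vert x (n + 1)) (rk x n)`.
Every vertex of level `n + 1` receives the same number `a n + n` of edges. The ranks are therefore
the digits of a mixed radix expansion, and the Vershik map (`succPath`) adds one with carry: its
effect on the ranks does not depend on the vertices. The first `n` ranks give the position
`pos x n` of a path in its tower of level `n`, a number below the common height `towerHeight a n`,
and `pos` advances by one modulo this height.

*Minimality and entropy.* Every vertex of level `n` is a source of edges into each vertex of level
`n + 1`, so every orbit meets every position of every tower (`exists_iterate_vert_eq`,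
`dense_orbit`). An orbit segment as long as the height of level `n`, seen up to level `n`, runs
through parts of at most two towers, so there are at most `(n + 1) ^ 2 * towerHeight a n` of these
segments, a number polynomial in their length (`coverEntropy_succPath`).

*Conjugacy.* The sequence of first edges along the orbit (`code`) determines the path. By induction
on `n` it determines the positions at level `n` and the parity of the vertices of level `n`: the
parities of the sources read along a tower of level `n + 1` recognize its base and determine the
word of the tower (`recognizability_step`). The words of the towers are the words
`composedWord`, so by minimality and compactness the image of `code` is the `S`-adic subshift
(`range_code`). The minimal path returns to each of its cylinders along an arithmetic progression,
and there are no periodic orbits, so the subshift is Toeplitz.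

*Measures.* Every invariant probability measure makes all positions at level `n` equally likely
(`measure_pos_eq`) and, given the vertex of level `n + 1`, also all ranks at level `n`
(`measure_vert_rk_eq`). All but at most `n + 2` of the `a n + n` edges into a vertex continue one
of the odometers, and `∑ (n + 2) / (a n + n)` converges. By the Borel-Cantelli lemma almost every path
eventually runs through the vertices of a single odometer, that is, belongs to some
`odoPaths a ha j` (`ae_exists_mem_odoPaths`). A path in this set is determined by its ranks, and all
invariant probability measures have the same projection to the ranks (`map_rk_eq`). Hence each set
`odoPaths a ha j` carries at most one invariant probability measure (`eq_of_odoPaths`), and it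
carries one, `odoMeasure`, which is obtained by lifting the common projection. Uniqueness makes it
ergodic, and ergodicity puts the whole mass of an ergodic measure on one of the sets.

*Rigidity.* The iterate of order `towerHeight a n` preserves the position at level `n`, and it
changes the vertex of level `n` only for ranks that are last or are followed by an edge with another
source. There are at most `n + 2` of these ranks, so the same bound applies
(`isRigidAlong_towerHeight`).
-/

/-! ### Words, dynamical covers and general Bratteli diagrams -/

lemma flatMap_range_map_range {α : Type*} (F : ℕ → α) (q h : ℕ) :
    ((List.range q).flatMap fun j => (List.range h).map fun k => F (k + j * h)) =
      (List.range (h * q)).map F := by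
  induction q with
  | zero => simp
  | succ q ih =>
    rw [List.range_succ, List.flatMap_append, ih, Nat.mul_succ, List.range_add, List.map_append]
    simp [Function.comp_def, add_comm, mul_comm]

lemma ofFn_isInfix_map_range {α : Type*} {F : ℕ → α} {t k L : ℕ} (h : t + k ≤ L) :
    List.ofFn (fun j : Fin k => F (t + j)) <:+: (List.range L).map F := by
  obtain ⟨r, rfl⟩ := Nat.exists_eq_add_of_le h
  refine ⟨(List.range t).map F, (List.range r).map fun i => F (t + k + i), ?_⟩
  rw [List.range_add, List.range_add, List.map_append, List.map_append, List.map_map, List.map_map]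
  congr 2
  exact List.ext_getElem (by simp) (by simp)

lemma exists_of_ofFn_isInfix_map_range {α : Type*} {F : ℕ → α} {k L : ℕ} {f : Fin k → α}
    (h : List.ofFn f <:+: (List.range L).map F) :
    ∃ t, t + k ≤ L ∧ ∀ j : Fin k, f j = F (t + j) := by
  obtain ⟨l₁, l₂, h⟩ := h
  have hlen := congrArg List.length h
  simp only [List.length_append, List.length_ofFn, List.length_map, List.length_range] at hlen
  refine ⟨l₁.length, by omega, fun j => ?_⟩
  have hj := congrArg (fun l => l[l₁.length + (j : ℕ)]?) h
  simpa [List.getElem?_append, show l₁.length + (j : ℕ) < L by omega] using hj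

/-- If the value of `f` at a point determines its orbit segment up to `U`, then choosing one point
for each value of `f` gives a dynamical cover. -/
lemma exists_dynCover {X ι : Type*} [Fintype ι] (T : X → X) (U : SetRel X X) (n : ℕ) (f : X → ι)
    (hf : ∀ x y, f x = f y → (x, y) ∈ Dynamics.dynEntourage T U n) :
    ∃ s : Finset X, Dynamics.IsDynCoverOf T univ U n s ∧ s.card ≤ Fintype.card ι := by
  classical
  have hfin : (range f).Finite := toFinite _
  refine ⟨hfin.toFinset.attach.image fun i => ((hfin.mem_toFinset).1 i.2).choose, fun x _ => ?_, ?_⟩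
  · have hx : f x ∈ hfin.toFinset := hfin.mem_toFinset.2 (mem_range_self x)
    refine ⟨_, Finset.mem_coe.2 (Finset.mem_image_of_mem _ (Finset.mem_attach _ ⟨f x, hx⟩)), ?_⟩
    exact hf _ _ ((hfin.mem_toFinset).1 hx).choose_spec.symm
  · refine Finset.card_image_le.trans ?_
    rw [Finset.card_attach]
    exact Finset.card_le_univ _

namespace OrderedBratteliDiagram

variable (B : OrderedBratteliDiagram)

instance (n : ℕ) : DiscreteTopology (B.E n) := ⟨rfl⟩

instance (n : ℕ) : DiscreteTopology (B.Alphabet n) := ⟨rfl⟩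

/-- A finite path to a vertex of positive level is an edge into this vertex, preceded by a path to
its source. -/
def pathToSuccEquiv (n : ℕ) (v : B.V (n + 1)) :
    B.PathTo (n + 1) v ≃ Σ e : {e : B.E n // B.tgt e = v}, B.PathTo n (B.src e.1) where
  toFun p := match p with
    | .cons e p => ⟨⟨e, rfl⟩, p⟩
  invFun q := q.1.2 ▸ .cons q.1.1 q.2
  left_inv p := by cases p; rfl
  right_inv q := by obtain ⟨⟨e, rfl⟩, p⟩ := q; rfl

lemma card_pathTo_zero (v : B.V 0) : Nat.card (B.PathTo 0 v) = 1 := by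
  rw [Nat.card_eq_one_iff_unique]
  refine ⟨⟨fun p q => ?_⟩, ⟨.nil v⟩⟩
  cases p
  cases q
  rfl

lemma mem_incoming {n : ℕ} {v : B.V (n + 1)} {e : B.E n} : e ∈ B.incoming v ↔ B.tgt e = v := by
  simp [incoming]

lemma nodup_incoming {n : ℕ} (v : B.V (n + 1)) : (B.incoming v).Nodup := by
  classical
  exact List.Nodup.map Subtype.val_injective (Finset.sort_nodup _ _)

lemma pairwise_incoming {n : ℕ} (v : B.V (n + 1)) : (B.incoming v).Pairwise (· ≤ ·) := by
  classical
  exact List.pairwise_map.2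
    (Finset.pairwise_sort _ (fun e f : {e : B.E n // B.tgt e = v} => e ≤ f))

lemma composedWord_one (v : B.V 1) :
    composedWord B.substitution 1 v = (B.incoming v).flatMap fun e => [e] := rfl

lemma composedWord_add_two (n : ℕ) (v : B.V (n + 2)) :
    composedWord B.substitution (n + 2) v =
      (B.incoming v).flatMap fun e => composedWord B.substitution (n + 1) (B.src e) :=
  List.flatMap_map B.src (composedWord B.substitution (n + 1)) (l := B.incoming v)

end OrderedBratteliDiagram

namespace CountableDiagram

/-! ### The edges into a vertex, by source and rank -/

/-- The number of edges into the vertex `w` of level `n + 1` whose source is smaller than `u`,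
that is, the rank of the first edge from `u` to `w`. -/
def startPos (a : ℕ → ℕ) (n w u : ℕ) : ℕ :=
  if w ≤ n then (if u ≤ w then u else u - 1 + a n)
  else if n = 0 then 0 else if u < n then u else n + 1

/-- The source of the edge of rank `j` into the vertex `w` of level `n + 1`: the words read on the
diagram are `0 1 ⋯ (w - 1) w ⋯ w (w + 1) ⋯ n` for `w ≤ n`, with `a n` letters `w`, and
`0 1 ⋯ (n - 1) (n - 1) n ⋯ n` for `w = n + 1`. -/
def sourceAt (a : ℕ → ℕ) (n w j : ℕ) : ℕ :=
  if w ≤ n then (if j < w then j else if j < w + a n then w else j - a n + 1)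
  else if j < n then j else if j = n then n - 1 else n

variable {a : ℕ → ℕ}

lemma sourceAt_le {n w j : ℕ} (hj : j < a n + n) : sourceAt a n w j ≤ n := by
  unfold sourceAt; split_ifs <;> omega

lemma startPos_sourceAt_le {n w j : ℕ} (_hj : j < a n + n) :
    startPos a n w (sourceAt a n w j) ≤ j := by
  unfold startPos sourceAt; split_ifs <;> omega

lemma lt_startPos_sourceAt_add {n w j : ℕ} (hj : j < a n + n) :
    j < startPos a n w (sourceAt a n w j) + edgeCount a n w (sourceAt a n w j) := by
  unfold startPos sourceAt edgeCount; split_ifs <;> omega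

lemma startPos_add_lt {n w u i : ℕ} (h0 : 0 < a n) (hu : u ≤ n) (hi : i < edgeCount a n w u) :
    startPos a n w u + i < a n + n := by
  unfold edgeCount at hi; unfold startPos; split_ifs at * <;> omega

lemma sourceAt_startPos_add {n w u i : ℕ} (h0 : 0 < a n) (hu : u ≤ n)
    (hi : i < edgeCount a n w u) : sourceAt a n w (startPos a n w u + i) = u := by
  unfold edgeCount at hi; unfold startPos sourceAt; split_ifs at * <;> omega

lemma startPos_add_edgeCount_le {n w u u' : ℕ} (hu' : u' ≤ n) (h : u < u') :
    startPos a n w u + edgeCount a n w u ≤ startPos a n w u' := by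
  unfold startPos edgeCount; split_ifs at * <;> omega

lemma sourceAt_mono {n w j j' : ℕ} (hj' : j ≤ j') : sourceAt a n w j ≤ sourceAt a n w j' := by
  unfold sourceAt; split_ifs <;> omega

lemma sourceAt_zero {n w : ℕ} (h0 : 0 < a n) (hw : w ≤ n + 1) : sourceAt a n w 0 = 0 := by
  unfold sourceAt; split_ifs <;> omega

lemma sourceAt_last {n w : ℕ} (h0 : 0 < a n) (h2 : 1 ≤ n → 2 ≤ a n) :
    sourceAt a n w (a n + n - 1) = n := by
  unfold sourceAt; split_ifs <;> omega

/-- The rank of an edge among the edges with the same target. -/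
def edgeRank {n : ℕ} (e : CountableEdge a n) : ℕ :=
  startPos a n e.1 (ofLex e.2).1 + (ofLex e.2).2

lemma edgeRank_lt {n : ℕ} (h0 : 0 < a n) (e : CountableEdge a n) : edgeRank e < a n + n :=
  startPos_add_lt h0 (Nat.lt_succ_iff.1 (ofLex e.2).1.2) (ofLex e.2).2.2

lemma source_eq {n : ℕ} (h0 : 0 < a n) (e : CountableEdge a n) :
    ((ofLex e.2).1 : ℕ) = sourceAt a n e.1 (edgeRank e) :=
  (sourceAt_startPos_add h0 (Nat.lt_succ_iff.1 (ofLex e.2).1.2) (ofLex e.2).2.2).symm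

lemma edge_ext {n : ℕ} (h0 : 0 < a n) {e f : CountableEdge a n} (ht : e.1 = f.1)
    (hr : edgeRank e = edgeRank f) : e = f := by
  have hs : (ofLex e.2).1 = (ofLex f.2).1 := by
    apply Fin.ext; rw [source_eq h0, source_eq h0, ht, hr]
  obtain ⟨w, p⟩ := e
  obtain ⟨w', p'⟩ := f
  obtain rfl : w = w' := ht
  obtain ⟨u, i⟩ := p
  obtain ⟨u', i'⟩ := p'
  obtain rfl : u = u' := hs
  obtain rfl : i = i' := by
    apply Fin.ext
    have : startPos a n w u + (i : ℕ) = startPos a n w u + i' := hr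
    omega
  rfl

/-- The edge of rank `j` into the vertex `w` of level `n + 1`. -/
def edgeAt (n : ℕ) (w : Fin (n + 2)) (j : ℕ) (hj : j < a n + n) : CountableEdge a n :=
  ⟨w, toLex ⟨⟨sourceAt a n w j, Nat.lt_succ_of_le (sourceAt_le hj)⟩,
    ⟨j - startPos a n w (sourceAt a n w j), by
      have := startPos_sourceAt_le (w := w) hj
      have := lt_startPos_sourceAt_add (w := w) hj
      dsimp only
      omega⟩⟩⟩

lemma edgeRank_edgeAt {n : ℕ} {w : Fin (n + 2)} {j : ℕ} (hj : j < a n + n) :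
    edgeRank (edgeAt n w j hj) = j :=
  Nat.add_sub_cancel' (startPos_sourceAt_le (w := w) hj)

lemma edgeAt_edgeRank {n : ℕ} (h0 : 0 < a n) (e : CountableEdge a n) :
    edgeAt n e.1 (edgeRank e) (edgeRank_lt h0 e) = e :=
  edge_ext h0 rfl (edgeRank_edgeAt _)

lemma edge_le_iff {n : ℕ} (e f : CountableEdge a n) :
    e ≤ f ↔ e.1 = f.1 ∧ edgeRank e ≤ edgeRank f := by
  obtain ⟨w, p⟩ := e
  obtain ⟨w', p'⟩ := f
  by_cases hw : w = w'
  swap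
  · refine iff_of_false (fun h => hw ?_) (fun h => hw h.1)
    obtain ⟨h, -⟩ := Sigma.le_def.1 h
    exact h
  subst hw
  rw [Sigma.mk_le_mk_iff]
  obtain ⟨u, i⟩ := p
  obtain ⟨u', i'⟩ := p'
  refine Sigma.Lex.le_def.trans ?_
  change (u < u' ∨ ∃ h : u = u', h ▸ i ≤ i') ↔
    w = w ∧ startPos a n w u + (i : ℕ) ≤ startPos a n w u' + i'
  rcases lt_trichotomy u u' with h | h | h
  · have := startPos_add_edgeCount_le (a := a) (w := w) (Nat.lt_succ_iff.1 u'.2) h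
    have := i.2
    simp only [h, true_or, true_and, true_iff]
    omega
  · subst h
    simp
  · have := startPos_add_edgeCount_le (a := a) (w := w) (Nat.lt_succ_iff.1 u.2) h
    have := i'.2
    refine iff_of_false ?_ ?_
    · rintro (h' | ⟨h', -⟩)
      · exact lt_asymm h h'
      · exact h.ne' h'
    · rintro ⟨-, h'⟩
      omega

/-! ### Paths as sequences of vertices and ranks -/

variable {ha : ∀ n, 0 < a n}

/-- The path space of the diagram. -/
abbrev Path (a : ℕ → ℕ) (ha : ∀ n, 0 < a n) : Type := (countableDiagram a ha).PathSpace

/-- The vertex of level `n` on the path `x`. -/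
def vert (x : Path a ha) (n : ℕ) : ℕ := ((countableDiagram a ha).src (x.1 n) : Fin (n + 1)).1

/-- The rank of the edge of `x` between the levels `n` and `n + 1`. -/
def rk (x : Path a ha) (n : ℕ) : ℕ := edgeRank (a := a) (x.1 n)

lemma vert_le (x : Path a ha) (n : ℕ) : vert x n ≤ n :=
  Nat.lt_succ_iff.1 ((countableDiagram a ha).src (x.1 n) : Fin (n + 1)).2

lemma tgt_eq_vert (x : Path a ha) (n : ℕ) :
    ((countableDiagram a ha).tgt (x.1 n) : Fin (n + 2)).1 = vert x (n + 1) :=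
  congrArg Fin.val (x.2 n)

lemma rk_lt (x : Path a ha) (n : ℕ) : rk x n < a n + n := edgeRank_lt (ha n) _

lemma vert_eq (x : Path a ha) (n : ℕ) : vert x n = sourceAt a n (vert x (n + 1)) (rk x n) := by
  rw [← tgt_eq_vert]
  exact source_eq (ha n) _

lemma edge_eq_iff {x y : Path a ha} {n : ℕ} :
    x.1 n = y.1 n ↔ vert x (n + 1) = vert y (n + 1) ∧ rk x n = rk y n := by
  constructor
  · intro h
    rw [← tgt_eq_vert, ← tgt_eq_vert, rk, rk, h]
    exact ⟨rfl, rfl⟩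
  · rintro ⟨h1, h2⟩
    rw [← tgt_eq_vert, ← tgt_eq_vert] at h1
    exact edge_ext (ha n) (Fin.ext h1) h2

/-- Going down from a common vertex along edges of equal ranks, two paths meet the same vertices. -/
lemma vert_eq_of_le {x y : Path a ha} {N : ℕ} (hv : vert x N = vert y N)
    (hr : ∀ i < N, rk x i = rk y i) {i : ℕ} (hi : i ≤ N) : vert x i = vert y i := by
  induction hk : N - i generalizing i with
  | zero => obtain rfl : i = N := by omega
            exact hv
  | succ k ih => rw [vert_eq x, vert_eq y, ih (i := i + 1) (by omega) (by omega), hr i (by omega)]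

lemma path_ext {x y : Path a ha} (hv : ∀ n, vert x (n + 1) = vert y (n + 1))
    (hr : ∀ n, rk x n = rk y n) : x = y :=
  Subtype.ext (funext fun n => edge_eq_iff.2 ⟨hv n, hr n⟩)

/-- The path with prescribed vertices and ranks. -/
def mkPath (w r : ℕ → ℕ) (hw : ∀ n, w n ≤ n) (hr : ∀ n, r n < a n + n)
    (h : ∀ n, w n = sourceAt a n (w (n + 1)) (r n)) : Path a ha :=
  ⟨fun n => edgeAt n ⟨w (n + 1), Nat.lt_succ_of_le (hw _)⟩ (r n) (hr n),
    fun n => Fin.ext (h (n + 1))⟩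

@[simp] lemma vert_mkPath {w r : ℕ → ℕ} (hw : ∀ n, w n ≤ n) (hr : ∀ n, r n < a n + n)
    (h : ∀ n, w n = sourceAt a n (w (n + 1)) (r n)) (n : ℕ) :
    vert (mkPath (ha := ha) w r hw hr h) n = w n := (h n).symm

@[simp] lemma rk_mkPath {w r : ℕ → ℕ} (hw : ∀ n, w n ≤ n) (hr : ∀ n, r n < a n + n)
    (h : ∀ n, w n = sourceAt a n (w (n + 1)) (r n)) (n : ℕ) :
    rk (mkPath (ha := ha) w r hw hr h) n = r n := edgeRank_edgeAt (hr n)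

/-! ### Topology of the path space -/

lemma continuous_edge (n : ℕ) : Continuous fun x : Path a ha => x.1 n :=
  (continuous_apply n).comp continuous_subtype_val

lemma isClosed_paths : IsClosed {x : (n : ℕ) → (countableDiagram a ha).E n |
    ∀ n, (countableDiagram a ha).tgt (x n) = (countableDiagram a ha).src (x (n + 1))} := by
  simp only [ofPred_forall]
  refine isClosed_iInter fun n => ?_
  let _ : TopologicalSpace ((countableDiagram a ha).V (n + 1)) := ⊥
  have _ : DiscreteTopology ((countableDiagram a ha).V (n + 1)) := ⟨rfl⟩
  exact isClosed_eq (continuous_of_discreteTopology.comp (continuous_apply n))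
    (continuous_of_discreteTopology.comp (continuous_apply (n + 1)))

instance : CompactSpace (Path a ha) := isCompact_iff_compactSpace.1 isClosed_paths.isCompact

instance : T2Space (Path a ha) := inferInstanceAs (T2Space {_x : (n : ℕ) → _ // _})

instance : PolishSpace (Path a ha) :=
  haveI (n : ℕ) : Countable ((countableDiagram a ha).E n) := Finite.to_countable
  haveI (n : ℕ) : PolishSpace ((countableDiagram a ha).E n) := inferInstance
  isClosed_paths.polishSpace

lemma isOpen_cylinder (x : Path a ha) (N : ℕ) :
    IsOpen {y : Path a ha | ∀ i < N, y.1 i = x.1 i} := by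
  have : {y : Path a ha | ∀ i < N, y.1 i = x.1 i} =
      ⋂ i ∈ Finset.range N, (fun y : Path a ha => y.1 i) ⁻¹' {x.1 i} := by
    ext y; simp
  rw [this]
  exact isOpen_biInter_finset fun i _ => (isOpen_discrete _).preimage (continuous_edge i)

/-- A map that depends on finitely many edges only is continuous. -/
lemma continuous_of_dependsOn {Y : Type*} [TopologicalSpace Y] {f : Path a ha → Y} (N : ℕ)
    (hf : ∀ x y : Path a ha, (∀ i < N, y.1 i = x.1 i) → f y = f x) : Continuous f :=
  ((IsLocallyConstant.iff_exists_open f).2 fun x =>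
    ⟨_, isOpen_cylinder x N, fun _ _ => rfl, fun y hy => hf x y hy⟩).continuous

lemma rk_eq_of_edge {x y : Path a ha} {n : ℕ} (h : y.1 n = x.1 n) : rk y n = rk x n := by
  rw [rk, rk, h]

lemma vert_eq_of_edge {x y : Path a ha} {n : ℕ} (h : y.1 n = x.1 n) : vert y n = vert x n := by
  rw [vert, vert, h]

lemma continuous_rk (n : ℕ) : Continuous fun x : Path a ha => rk x n :=
  continuous_of_dependsOn (n + 1) fun _ _ h => rk_eq_of_edge (h n (by omega))

lemma continuous_vert (n : ℕ) : Continuous fun x : Path a ha => vert x n :=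
  continuous_of_dependsOn (n + 1) fun _ _ h => vert_eq_of_edge (h n (by omega))

lemma exists_cylinder_subset {U : Set (Path a ha)} (hU : IsOpen U) {x : Path a ha} (hx : x ∈ U) :
    ∃ N, {y : Path a ha | ∀ i < N, y.1 i = x.1 i} ⊆ U := by
  obtain ⟨V, hV, rfl⟩ := isOpen_induced_iff.1 hU
  obtain ⟨I, u, hu, hI⟩ := isOpen_pi_iff.1 hV x.1 hx
  refine ⟨I.sup id + 1, fun y hy => hI fun i hi => ?_⟩
  have hle : i ≤ I.sup id := Finset.le_sup (f := id) hi
  rw [hy i (by omega)]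
  exact (hu i hi).2

/-! ### The Vershik map -/

/-- The first `n` edges of the path are maximal. -/
def MaxBelow (x : Path a ha) (n : ℕ) : Prop := ∀ i < n, rk x i + 1 = a i + i

/-- The first `n` edges of the path are minimal. -/
def MinBelow (x : Path a ha) (n : ℕ) : Prop := ∀ i < n, rk x i = 0

lemma maxBelow_succ {x : Path a ha} {n : ℕ} :
    MaxBelow x (n + 1) ↔ MaxBelow x n ∧ rk x n + 1 = a n + n := by
  simp only [MaxBelow, Nat.forall_lt_succ_right]

lemma minBelow_succ {x : Path a ha} {n : ℕ} :
    MinBelow x (n + 1) ↔ MinBelow x n ∧ rk x n = 0 := by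
  simp only [MinBelow, Nat.forall_lt_succ_right]

open Classical in
/-- The vertices of the successor of `x`. -/
noncomputable def succVert (x : Path a ha) (n : ℕ) : ℕ :=
  if MaxBelow x (n + 1) then 0
  else if MaxBelow x n then sourceAt a n (vert x (n + 1)) (rk x n + 1) else vert x n

open Classical in
/-- The ranks of the successor of `x`: one is added, with carry. -/
noncomputable def succRk (x : Path a ha) (n : ℕ) : ℕ :=
  if MaxBelow x (n + 1) then 0 else if MaxBelow x n then rk x n + 1 else rk x n

open Classical in
/-- The vertices of the predecessor of `x`. -/
noncomputable def predVert (x : Path a ha) (n : ℕ) : ℕ :=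
  if MinBelow x (n + 1) then n
  else if MinBelow x n then sourceAt a n (vert x (n + 1)) (rk x n - 1) else vert x n

open Classical in
/-- The ranks of the predecessor of `x`: one is subtracted, with borrow. -/
noncomputable def predRk (x : Path a ha) (n : ℕ) : ℕ :=
  if MinBelow x (n + 1) then a n + n - 1 else if MinBelow x n then rk x n - 1 else rk x n

lemma succRk_lt (x : Path a ha) (n : ℕ) : succRk x n < a n + n := by
  have := rk_lt x n
  have := ha n
  unfold succRk
  split_ifs with h1 h2
  · omega
  · rw [maxBelow_succ] at h1
    have : rk x n + 1 ≠ a n + n := fun h => h1 ⟨h2, h⟩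
    omega
  · omega

lemma predRk_lt (x : Path a ha) (n : ℕ) : predRk x n < a n + n := by
  have := rk_lt x n
  unfold predRk
  split_ifs <;> omega

lemma succVert_le (x : Path a ha) (n : ℕ) : succVert x n ≤ n := by
  have hr := succRk_lt x n
  have := vert_le x n
  unfold succVert
  unfold succRk at hr
  split_ifs at * with h1 h2
  · omega
  · exact sourceAt_le hr
  · omega

lemma predVert_le (x : Path a ha) (n : ℕ) : predVert x n ≤ n := by
  have hr := predRk_lt x n
  have := vert_le x n
  unfold predVert
  unfold predRk at hr
  split_ifs at * with h1 h2
  · omega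
  · exact sourceAt_le hr
  · omega

lemma succVert_of_not {x : Path a ha} {n : ℕ} (h : ¬ MaxBelow x n) : succVert x n = vert x n := by
  rw [succVert, if_neg (fun h' => h (maxBelow_succ.1 h').1), if_neg h]

lemma predVert_of_not {x : Path a ha} {n : ℕ} (h : ¬ MinBelow x n) : predVert x n = vert x n := by
  rw [predVert, if_neg (fun h' => h (minBelow_succ.1 h').1), if_neg h]

lemma succVert_eq (x : Path a ha) (n : ℕ) :
    succVert x n = sourceAt a n (succVert x (n + 1)) (succRk x n) := by
  by_cases h1 : MaxBelow x (n + 1)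
  · rw [succVert, if_pos h1, succRk, if_pos h1, sourceAt_zero (ha n) (succVert_le x _)]
  · rw [succVert_of_not h1, succRk, if_neg h1, succVert, if_neg h1]
    split_ifs
    · rfl
    · exact vert_eq x n

lemma predVert_eq (h2 : ∀ n, 1 ≤ n → 2 ≤ a n) (x : Path a ha) (n : ℕ) :
    predVert x n = sourceAt a n (predVert x (n + 1)) (predRk x n) := by
  by_cases h1 : MinBelow x (n + 1)
  · rw [predVert, if_pos h1, predRk, if_pos h1, sourceAt_last (ha n) (h2 n)]
  · rw [predVert_of_not h1, predRk, if_neg h1, predVert, if_neg h1]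
    split_ifs
    · rfl
    · exact vert_eq x n

/-- The successor of a path. The maximal path is sent to the minimal path. -/
noncomputable def succPath (x : Path a ha) : Path a ha :=
  mkPath (succVert x) (succRk x) (succVert_le x) (succRk_lt x) (succVert_eq x)

/-- The predecessor of a path. The minimal path is sent to the maximal path. -/
noncomputable def predPath (h2 : ∀ n, 1 ≤ n → 2 ≤ a n) (x : Path a ha) : Path a ha :=
  mkPath (predVert x) (predRk x) (predVert_le x) (predRk_lt x) (predVert_eq h2 x)

@[simp] lemma rk_succPath (x : Path a ha) (n : ℕ) : rk (succPath x) n = succRk x n :=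
  rk_mkPath _ _ _ _

@[simp] lemma vert_succPath (x : Path a ha) (n : ℕ) : vert (succPath x) n = succVert x n :=
  vert_mkPath _ _ _ _

@[simp] lemma rk_predPath (h2 : ∀ n, 1 ≤ n → 2 ≤ a n) (x : Path a ha) (n : ℕ) :
    rk (predPath h2 x) n = predRk x n :=
  rk_mkPath _ _ _ _

@[simp] lemma vert_predPath (h2 : ∀ n, 1 ≤ n → 2 ≤ a n) (x : Path a ha) (n : ℕ) :
    vert (predPath h2 x) n = predVert x n :=
  vert_mkPath _ _ _ _

lemma minBelow_succPath (x : Path a ha) (n : ℕ) : MinBelow (succPath x) n ↔ MaxBelow x n := by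
  induction n with
  | zero => simp [MinBelow, MaxBelow]
  | succ n ih =>
    rw [minBelow_succ, ih, rk_succPath]
    constructor
    · rintro ⟨h1, h2⟩
      by_contra h
      simp [succRk, h, h1] at h2
    · intro h
      exact ⟨(maxBelow_succ.1 h).1, by simp [succRk, h]⟩

lemma maxBelow_predPath (h2 : ∀ n, 1 ≤ n → 2 ≤ a n) (x : Path a ha) (n : ℕ) :
    MaxBelow (predPath h2 x) n ↔ MinBelow x n := by
  induction n with
  | zero => simp [MinBelow, MaxBelow]
  | succ n ih =>
    rw [maxBelow_succ, ih, rk_predPath]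
    have := rk_lt x n
    constructor
    · rintro ⟨h1, h3⟩
      rw [minBelow_succ]
      refine ⟨h1, ?_⟩
      by_contra h0
      simp only [predRk, minBelow_succ, h1, h0, and_false, if_false, if_true] at h3
      omega
    · intro h
      refine ⟨(minBelow_succ.1 h).1, ?_⟩
      simp only [predRk, h, if_true]
      omega

lemma predPath_succPath (h2 : ∀ n, 1 ≤ n → 2 ≤ a n) (x : Path a ha) :
    predPath h2 (succPath x) = x := by
  classical
  have hr (n : ℕ) : rk (predPath h2 (succPath x)) n = rk x n := by
    rw [rk_predPath, predRk]
    rw [if_congr (minBelow_succPath x _) rfl (if_congr (minBelow_succPath x _) rfl rfl),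
      rk_succPath, succRk]
    split_ifs with h h'
    · have := (maxBelow_succ.1 h).2; omega
    · omega
    · rfl
  by_cases hx : ∀ n, MaxBelow x n
  · refine path_ext (fun n => ?_) hr
    rw [vert_predPath, predVert, if_pos ((minBelow_succPath _ _).2 (hx _)), vert_eq x]
    rw [show rk x (n + 1) = a (n + 1) + (n + 1) - 1 by
      have := hx (n + 2) (n + 1) (by omega); omega]
    exact (sourceAt_last (ha _) (h2 _)).symm
  · push Not at hx
    obtain ⟨N, hN⟩ := hx
    have hlarge {n : ℕ} (hn : N ≤ n) : vert (predPath h2 (succPath x)) n = vert x n := by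
      have hn' : ¬ MaxBelow x n := fun h => hN fun i hi => h i (by omega)
      rw [vert_predPath, predVert_of_not (by rwa [minBelow_succPath]), vert_succPath,
        succVert_of_not hn']
    refine path_ext (fun n => ?_) hr
    exact vert_eq_of_le (hlarge (by omega : N ≤ N + n + 1)) (fun i _ => hr i) (by omega)

lemma succPath_predPath (h2 : ∀ n, 1 ≤ n → 2 ≤ a n) (x : Path a ha) :
    succPath (predPath h2 x) = x := by
  classical
  have hr (n : ℕ) : rk (succPath (predPath h2 x)) n = rk x n := by
    rw [rk_succPath, succRk]
    rw [if_congr (maxBelow_predPath h2 x _) rfl (if_congr (maxBelow_predPath h2 x _) rfl rfl),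
      rk_predPath, predRk]
    split_ifs with h h'
    · exact (minBelow_succ.1 h).2.symm
    · have : rk x n ≠ 0 := fun h0 => h (minBelow_succ.2 ⟨h', h0⟩)
      omega
    · rfl
  by_cases hx : ∀ n, MinBelow x n
  · refine path_ext (fun n => ?_) hr
    rw [vert_succPath, succVert, if_pos ((maxBelow_predPath _ _ _).2 (hx _)), vert_eq x,
      hx (n + 2) (n + 1) (by omega), sourceAt_zero (ha _) (vert_le x _)]
  · push Not at hx
    obtain ⟨N, hN⟩ := hx
    have hlarge {n : ℕ} (hn : N ≤ n) : vert (succPath (predPath h2 x)) n = vert x n := by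
      have hn' : ¬ MinBelow x n := fun h => hN fun i hi => h i (by omega)
      rw [vert_succPath, succVert_of_not (by rwa [maxBelow_predPath]), vert_predPath,
        predVert_of_not hn']
    refine path_ext (fun n => ?_) hr
    exact vert_eq_of_le (hlarge (by omega : N ≤ N + n + 1)) (fun i _ => hr i) (by omega)

lemma continuous_succPath : Continuous (succPath : Path a ha → Path a ha) := by
  classical
  refine Continuous.subtype_mk (continuous_pi fun n => ?_) _
  refine continuous_of_dependsOn (n + 3) fun x y h => ?_
  have hM (m : ℕ) (hm : m ≤ n + 2) : MaxBelow y m ↔ MaxBelow x m := by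
    refine forall₂_congr fun i hi => ?_
    rw [rk_eq_of_edge (h i (by omega))]
  have hv (m : ℕ) (hm : m ≤ n + 2) : vert y m = vert x m := vert_eq_of_edge (h m (by omega))
  have hr (m : ℕ) (hm : m ≤ n + 2) : rk y m = rk x m := rk_eq_of_edge (h m (by omega))
  refine (edge_eq_iff (x := succPath y) (y := succPath x)).2 ⟨?_, ?_⟩
  · rw [vert_succPath, vert_succPath, succVert, succVert, hv _ (by omega), hv _ (by omega),
      hr _ (by omega)]
    exact if_congr (hM _ (by omega)) rfl (if_congr (hM _ (by omega)) rfl rfl)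
  · rw [rk_succPath, rk_succPath, succRk, succRk, hr _ (by omega)]
    exact if_congr (hM _ (by omega)) rfl (if_congr (hM _ (by omega)) rfl rfl)

/-- The Vershik map as a homeomorphism. -/
noncomputable def vershik (h2 : ∀ n, 1 ≤ n → 2 ≤ a n) : Path a ha ≃ₜ Path a ha :=
  Continuous.homeoOfEquivCompactToT2
    (f := ⟨succPath, predPath h2, predPath_succPath h2, succPath_predPath h2⟩) continuous_succPath

@[simp] lemma vershik_apply (h2 : ∀ n, 1 ≤ n → 2 ≤ a n) (x : Path a ha) :
    vershik h2 x = succPath x := rfl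

/-! ### Towers: the position of a path and the orbits inside a tower -/

/-- The height of the towers of level `n`. -/
def towerHeight (a : ℕ → ℕ) (n : ℕ) : ℕ := ∏ i ∈ Finset.range n, (a i + i)

@[simp] lemma towerHeight_zero : towerHeight a 0 = 1 := rfl

lemma towerHeight_succ (n : ℕ) : towerHeight a (n + 1) = towerHeight a n * (a n + n) :=
  Finset.prod_range_succ _ _

lemma towerHeight_pos (ha : ∀ n, 0 < a n) (n : ℕ) : 0 < towerHeight a n :=
  Finset.prod_pos fun i _ => Nat.add_pos_left (ha i) i

lemma le_towerHeight (ha : ∀ n, 0 < a n) (h2 : ∀ n, 1 ≤ n → 2 ≤ a n) (n : ℕ) :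
    n ≤ towerHeight a n := by
  induction n with
  | zero => simp
  | succ n ih =>
    rw [towerHeight_succ]
    rcases Nat.eq_zero_or_pos n with rfl | hn
    · simpa [towerHeight] using Nat.succ_le_of_lt (ha 0)
    · have := h2 n hn
      nlinarith

lemma tendsto_towerHeight (ha : ∀ n, 0 < a n) (h2 : ∀ n, 1 ≤ n → 2 ≤ a n) :
    Tendsto (towerHeight a) atTop atTop :=
  tendsto_atTop_mono (le_towerHeight ha h2) tendsto_id

/-- The position of the path `x` in its tower of level `n`: the first `n` ranks, read in the mixed
radix numeral system of the heights. -/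
def pos (x : Path a ha) (n : ℕ) : ℕ := ∑ i ∈ Finset.range n, rk x i * towerHeight a i

@[simp] lemma pos_zero (x : Path a ha) : pos x 0 = 0 := rfl

lemma pos_succ (x : Path a ha) (n : ℕ) : pos x (n + 1) = pos x n + rk x n * towerHeight a n :=
  Finset.sum_range_succ _ _

lemma pos_lt (x : Path a ha) (n : ℕ) : pos x n < towerHeight a n := by
  induction n with
  | zero => simp
  | succ n ih =>
    rw [pos_succ, towerHeight_succ]
    have := rk_lt x n
    nlinarith

lemma pos_mod (x : Path a ha) (n : ℕ) : pos x (n + 1) % towerHeight a n = pos x n := by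
  rw [pos_succ, Nat.add_mul_mod_self_right, Nat.mod_eq_of_lt (pos_lt x n)]

lemma pos_div (x : Path a ha) (n : ℕ) : pos x (n + 1) / towerHeight a n = rk x n := by
  rw [pos_succ, Nat.add_mul_div_right _ _ (towerHeight_pos ha n), Nat.div_eq_of_lt (pos_lt x n),
    zero_add]

lemma rk_eq_of_pos_eq {x y : Path a ha} {n : ℕ} (h : pos x n = pos y n) :
    ∀ i < n, rk x i = rk y i := by
  induction n with
  | zero => simp
  | succ n ih =>
    rw [Nat.forall_lt_succ_right]
    exact ⟨ih (by rw [← pos_mod, h, pos_mod]), by rw [← pos_div, h, pos_div]⟩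

lemma pos_congr {x y : Path a ha} {n : ℕ} (h : ∀ i < n, rk x i = rk y i) : pos x n = pos y n :=
  Finset.sum_congr rfl fun i hi => by rw [h i (Finset.mem_range.1 hi)]

/-- A path is determined up to level `n` by its tower and its position in it. -/
lemma edge_eq_of_pos_eq {x y : Path a ha} {n : ℕ} (hv : vert x n = vert y n)
    (hp : pos x n = pos y n) : ∀ i < n, x.1 i = y.1 i := fun i hi =>
  edge_eq_iff.2 ⟨vert_eq_of_le hv (rk_eq_of_pos_eq hp) hi, rk_eq_of_pos_eq hp i hi⟩

lemma pos_eq_zero_iff {x : Path a ha} {n : ℕ} : pos x n = 0 ↔ MinBelow x n := by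
  simp only [pos, Finset.sum_eq_zero_iff, Finset.mem_range, mul_eq_zero,
    (towerHeight_pos ha _).ne', or_false, MinBelow]

lemma pos_add_one_eq_iff {x : Path a ha} {n : ℕ} :
    pos x n + 1 = towerHeight a n ↔ MaxBelow x n := by
  induction n with
  | zero => simp [MaxBelow]
  | succ n ih =>
    rw [maxBelow_succ, ← ih, pos_succ, towerHeight_succ]
    have h1 := pos_lt x n
    have h2 := rk_lt x n
    constructor
    · intro h
      have h3 : rk x n + 1 = a n + n := by
        by_contra hne
        have : rk x n + 2 ≤ a n + n := by omega
        nlinarith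
      refine ⟨?_, h3⟩
      rw [← h3] at h
      nlinarith
    · rintro ⟨h3, h4⟩
      rw [← h4]
      nlinarith

lemma succRk_of_not {x : Path a ha} {n : ℕ} (h : ¬ MaxBelow x n) : succRk x n = rk x n := by
  rw [succRk, if_neg (fun h' => h (maxBelow_succ.1 h').1), if_neg h]

lemma pos_succPath_of_max {x : Path a ha} {n : ℕ} (h : MaxBelow x n) : pos (succPath x) n = 0 :=
  pos_eq_zero_iff.2 ((minBelow_succPath x n).2 h)

lemma pos_succPath_of_not {x : Path a ha} {n : ℕ} (h : ¬ MaxBelow x n) :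
    pos (succPath x) n = pos x n + 1 := by
  induction n with
  | zero => simp [MaxBelow] at h
  | succ n ih =>
    rw [pos_succ, pos_succ, rk_succPath]
    by_cases hn : MaxBelow x n
    · rw [pos_succPath_of_max hn, succRk, if_neg h, if_pos hn]
      have := pos_add_one_eq_iff.2 hn
      rw [← this]
      ring
    · rw [ih hn, succRk_of_not hn]
      ring

lemma pos_succPath (x : Path a ha) (n : ℕ) :
    pos (succPath x) n = (pos x n + 1) % towerHeight a n := by
  by_cases h : MaxBelow x n
  · rw [pos_succPath_of_max h, pos_add_one_eq_iff.2 h, Nat.mod_self]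
  · rw [pos_succPath_of_not h, Nat.mod_eq_of_lt]
    have := pos_lt x n
    have := mt pos_add_one_eq_iff.1 h
    omega

lemma pos_iterate (x : Path a ha) (n k : ℕ) :
    pos (succPath^[k] x) n = (pos x n + k) % towerHeight a n := by
  induction k with
  | zero => simp [Nat.mod_eq_of_lt (pos_lt x n)]
  | succ k ih => rw [Function.iterate_succ_apply', pos_succPath, ih, Nat.mod_add_mod, add_assoc]

/-- As long as an orbit stays in a tower of level `n`, it does not change from level `n` on. -/
lemma iterate_of_lt {x : Path a ha} {n k : ℕ} (h : pos x n + k < towerHeight a n) :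
    pos (succPath^[k] x) n = pos x n + k ∧
      ∀ i, n ≤ i → vert (succPath^[k] x) i = vert x i ∧ rk (succPath^[k] x) i = rk x i := by
  induction k with
  | zero => simp
  | succ k ih =>
    obtain ⟨h1, h2⟩ := ih (by omega)
    have hM : ¬ MaxBelow (succPath^[k] x) n := by
      rw [← pos_add_one_eq_iff, h1]
      omega
    rw [Function.iterate_succ_apply']
    refine ⟨by rw [pos_succPath_of_not hM, h1, add_assoc], fun i hi => ?_⟩
    have hM' : ¬ MaxBelow (succPath^[k] x) i := fun h' => hM fun j hj => h' j (by omega)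
    rw [vert_succPath, succVert_of_not hM', rk_succPath, succRk_of_not hM']
    exact h2 i hi

/-- Inside a tower of level `n + 1`, the iterates by multiples of the height of level `n` move
through the subtowers of level `n`. -/
lemma iterate_mul_towerHeight {x : Path a ha} {n j : ℕ} (h : rk x n + j < a n + n) :
    pos (succPath^[j * towerHeight a n] x) n = pos x n ∧
      rk (succPath^[j * towerHeight a n] x) n = rk x n + j ∧
      ∀ i, n < i → vert (succPath^[j * towerHeight a n] x) i = vert x i ∧
        rk (succPath^[j * towerHeight a n] x) i = rk x i := by
  have hlt : pos x (n + 1) + j * towerHeight a n < towerHeight a (n + 1) := by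
    rw [pos_succ, towerHeight_succ]
    have := pos_lt x n
    nlinarith
  obtain ⟨h1, h2⟩ := iterate_of_lt hlt
  refine ⟨?_, ?_, fun i hi => h2 i hi⟩
  · rw [← pos_mod, h1, Nat.add_mul_mod_self_right, pos_mod]
  · rw [← pos_div, h1, Nat.add_mul_div_right _ _ (towerHeight_pos ha n), pos_div]

lemma exists_sourceAt_eq (ha : ∀ n, 0 < a n) (h2 : ∀ n, 1 ≤ n → 2 ≤ a n) {n u : ℕ} (w : ℕ)
    (hu : u ≤ n) : ∃ j < a n + n, sourceAt a n w j = u := by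
  have hpos : 0 < edgeCount a n w u := by
    have h1 := ha n
    have h3 := h2 n
    unfold edgeCount
    split_ifs <;> omega
  exact ⟨_, startPos_add_lt (ha n) hu hpos, sourceAt_startPos_add (ha n) hu hpos⟩

/-- A path with prescribed ranks below level `N`, and prescribed vertices and ranks above. -/
lemma exists_path_of_tail (N : ℕ) {w r : ℕ → ℕ} (hw : ∀ n, N ≤ n → w n ≤ n)
    (hr : ∀ n, r n < a n + n) (h : ∀ n, N ≤ n → w n = sourceAt a n (w (n + 1)) (r n)) :
    ∃ x : Path a ha, (∀ n, rk x n = r n) ∧ ∀ n, N ≤ n → vert x n = w n := by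
  induction N generalizing w with
  | zero =>
    exact ⟨mkPath w r (fun n => hw n n.zero_le) hr fun n => h n n.zero_le, rk_mkPath _ _ _,
      fun n _ => vert_mkPath _ _ _ n⟩
  | succ N ih =>
    obtain ⟨x, hx, hx'⟩ := ih (w := fun n => if n = N then sourceAt a n (w (n + 1)) (r n) else w n)
      (fun n hn => by
        split_ifs
        · exact sourceAt_le (hr n)
        · exact hw n (by omega))
      (fun n hn => by
        rcases eq_or_lt_of_le hn with rfl | hn
        · simp
        · rw [if_neg (by omega), if_neg (by omega), h n hn])
    refine ⟨x, hx, fun n hn => ?_⟩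
    rw [hx' n (by omega), if_neg (by omega)]

lemma exists_path_vert_eq {n v : ℕ} (hv : v ≤ n) :
    ∃ x : Path a ha, vert x n = v ∧ pos x n = 0 := by
  -- From level `n` on the path stays at `v`: the edge of rank `v` into `v` comes from `v`.
  obtain ⟨x, hx, hx'⟩ := exists_path_of_tail (a := a) (ha := ha) n (w := fun _ => v)
    (r := fun i => if i < n then 0 else v) (fun i hi => hv.trans hi)
    (fun i => by have := ha i; split_ifs <;> omega)
    (fun i hi => by
      have := ha i
      simp only [sourceAt]
      split_ifs <;> omega)
  refine ⟨x, hx' n le_rfl, pos_eq_zero_iff.2 fun i hi => ?_⟩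
  rw [hx, if_pos hi]

/-! ### Minimality and the absence of periodic orbits -/

/-- Every forward orbit visits every position of every tower. -/
lemma exists_iterate_vert_eq (h2 : ∀ n, 1 ≤ n → 2 ≤ a n) (x : Path a ha) {n v k : ℕ} (hv : v ≤ n)
    (hk : k < towerHeight a n) :
    ∃ t, vert (succPath^[t] x) n = v ∧ pos (succPath^[t] x) n = k := by
  set y := succPath^[towerHeight a (n + 1) - pos x (n + 1)] x with hy
  have hy0 : pos y (n + 1) = 0 := by
    rw [hy, pos_iterate, Nat.add_sub_cancel' (pos_lt x _).le, Nat.mod_self]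
  obtain ⟨j, hj, hjv⟩ := exists_sourceAt_eq ha h2 (vert y (n + 1)) hv
  have hlt : pos y (n + 1) + (k + j * towerHeight a n) < towerHeight a (n + 1) := by
    rw [hy0, towerHeight_succ]
    nlinarith
  obtain ⟨h1, h3⟩ := iterate_of_lt hlt
  refine ⟨k + j * towerHeight a n + (towerHeight a (n + 1) - pos x (n + 1)), ?_⟩
  rw [Function.iterate_add_apply, ← hy]
  constructor
  · rw [vert_eq, (h3 (n + 1) le_rfl).1, ← pos_div, h1, hy0, zero_add,
      Nat.add_mul_div_right _ _ (towerHeight_pos ha n), Nat.div_eq_of_lt hk, zero_add, hjv]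
  · rw [← pos_mod, h1, hy0, zero_add, Nat.add_mul_mod_self_right, Nat.mod_eq_of_lt hk]

lemma dense_orbit (h2 : ∀ n, 1 ≤ n → 2 ≤ a n) (x : Path a ha) :
    Dense (range fun k : ℕ => succPath^[k] x) := by
  rw [dense_iff_inter_open]
  rintro U hU ⟨z, hz⟩
  obtain ⟨N, hN⟩ := exists_cylinder_subset hU hz
  obtain ⟨t, ht, ht'⟩ := exists_iterate_vert_eq h2 x (vert_le z N) (pos_lt z N)
  exact ⟨_, hN (edge_eq_of_pos_eq ht ht'), t, rfl⟩

lemma iterate_ne_self (h2 : ∀ n, 1 ≤ n → 2 ≤ a n) (x : Path a ha) {k : ℕ} (hk : 0 < k) :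
    succPath^[k] x ≠ x := by
  intro h
  have h1 := pos_iterate x (k + 1) k
  have h3 := le_towerHeight ha h2 (k + 1)
  have h4 := pos_lt x (k + 1)
  rw [h] at h1
  rcases lt_or_ge (pos x (k + 1) + k) (towerHeight a (k + 1)) with h5 | h5
  · rw [Nat.mod_eq_of_lt h5] at h1
    omega
  · rw [Nat.mod_eq_sub_mod h5, Nat.mod_eq_of_lt (by omega)] at h1
    omega

/-! ### The order on the edges and the Vershik rule -/

lemma isMin_edge_iff {n : ℕ} (h0 : 0 < a n) (e : CountableEdge a n) :
    IsMin e ↔ edgeRank e = 0 := by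
  constructor
  · intro h
    have hle : edgeAt n e.1 0 (by omega) ≤ e :=
      (edge_le_iff _ _).2 ⟨rfl, by rw [edgeRank_edgeAt]; exact Nat.zero_le _⟩
    have := ((edge_le_iff _ _).1 (h hle)).2
    rw [edgeRank_edgeAt] at this
    omega
  · intro h f hf
    rw [edge_le_iff] at hf ⊢
    exact ⟨hf.1.symm, by omega⟩

lemma isMax_edge_iff {n : ℕ} (h0 : 0 < a n) (e : CountableEdge a n) :
    IsMax e ↔ edgeRank e + 1 = a n + n := by
  have he := edgeRank_lt h0 e
  constructor
  · intro h
    have hle : e ≤ edgeAt n e.1 (a n + n - 1) (by omega) :=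
      (edge_le_iff _ _).2 ⟨rfl, by rw [edgeRank_edgeAt]; omega⟩
    have := ((edge_le_iff _ _).1 (h hle)).2
    rw [edgeRank_edgeAt] at this
    omega
  · intro h f hf
    have := edgeRank_lt h0 f
    rw [edge_le_iff] at hf ⊢
    exact ⟨hf.1.symm, by omega⟩

lemma edge_lt_iff {n : ℕ} (e f : CountableEdge a n) :
    e < f ↔ e.1 = f.1 ∧ edgeRank e < edgeRank f := by
  rw [lt_iff_le_not_ge, edge_le_iff, edge_le_iff]
  constructor
  · rintro ⟨⟨h1, h2⟩, h3⟩
    exact ⟨h1, not_le.1 fun h => h3 ⟨h1.symm, h⟩⟩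
  · rintro ⟨h1, h2⟩
    exact ⟨⟨h1, h2.le⟩, fun h => by omega⟩

lemma edge_covBy_iff {n : ℕ} (h0 : 0 < a n) (e f : CountableEdge a n) :
    e ⋖ f ↔ e.1 = f.1 ∧ edgeRank f = edgeRank e + 1 := by
  constructor
  · rintro ⟨h1, h2⟩
    have hf := edgeRank_lt h0 f
    rw [edge_lt_iff] at h1
    refine ⟨h1.1, ?_⟩
    by_contra hne
    have hlt : edgeRank e + 1 < a n + n := by omega
    refine h2 (c := edgeAt n e.1 _ hlt) ((edge_lt_iff _ _).2 ⟨rfl, ?_⟩)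
      ((edge_lt_iff _ _).2 ⟨h1.1, ?_⟩) <;> rw [edgeRank_edgeAt] <;> omega
  · rintro ⟨h1, h2⟩
    refine ⟨(edge_lt_iff _ _).2 ⟨h1, by omega⟩, fun c hc hc' => ?_⟩
    rw [edge_lt_iff] at hc hc'
    omega

lemma isMin_iff (x : Path a ha) (n : ℕ) : IsMin (x.1 n) ↔ rk x n = 0 := isMin_edge_iff (ha n) _

lemma isMax_iff (x : Path a ha) (n : ℕ) : IsMax (x.1 n) ↔ rk x n + 1 = a n + n :=
  isMax_edge_iff (ha n) _

lemma covBy_iff (x y : Path a ha) (n : ℕ) :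
    x.1 n ⋖ y.1 n ↔ vert x (n + 1) = vert y (n + 1) ∧ rk y n = rk x n + 1 := by
  rw [← tgt_eq_vert, ← tgt_eq_vert]
  exact (edge_covBy_iff (ha n) _ _).trans (and_congr_left fun _ => Fin.ext_iff)

lemma source_eq_of_between {n : ℕ} (h0 : 0 < a n) {e f g : CountableEdge a n} (hef : e ≤ f)
    (hfg : f ≤ g) (heg : (ofLex e.2).1 = (ofLex g.2).1) : (ofLex f.2).1 = (ofLex e.2).1 := by
  rw [edge_le_iff] at hef hfg
  have h1 := sourceAt_mono (a := a) (n := n) (w := f.1) hef.2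
  have h2 := sourceAt_mono (a := a) (n := n) (w := f.1) hfg.2
  rw [Fin.ext_iff, source_eq h0, source_eq h0, hef.1, ← hfg.1] at heg
  apply Fin.ext
  rw [source_eq h0, source_eq h0, hef.1]
  omega

lemma isConsecutive : (countableDiagram a ha).IsConsecutive :=
  fun n _ _ _ hef hfg heg => source_eq_of_between (ha n) hef hfg heg

lemma mem_minPaths_iff {x : Path a ha} :
    x ∈ (countableDiagram a ha).minPaths ↔ ∀ n, rk x n = 0 :=
  forall_congr' fun n => isMin_iff x n

lemma mem_maxPaths_iff {x : Path a ha} :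
    x ∈ (countableDiagram a ha).maxPaths ↔ ∀ n, rk x n + 1 = a n + n :=
  forall_congr' fun n => isMax_iff x n

lemma existsUnique_minPath : ∃! x, x ∈ (countableDiagram a ha).minPaths := by
  simp only [mem_minPaths_iff]
  refine ⟨mkPath (fun _ => 0) (fun _ => 0) (fun n => n.zero_le) (fun n => Nat.add_pos_left (ha n) n)
    (fun n => (sourceAt_zero (ha n) (n + 1).zero_le).symm), rk_mkPath _ _ _, fun y hy => ?_⟩
  refine path_ext (fun n => ?_) fun n => by rw [hy, rk_mkPath]
  rw [vert_mkPath, vert_eq, hy, sourceAt_zero (ha _) (vert_le y _)]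

lemma existsUnique_maxPath (h2 : ∀ n, 1 ≤ n → 2 ≤ a n) :
    ∃! x, x ∈ (countableDiagram a ha).maxPaths := by
  simp only [mem_maxPaths_iff]
  have hq (n : ℕ) : a n + n - 1 < a n + n := by have := ha n; omega
  have hr := rk_mkPath (ha := ha) (w := id) (r := fun n => a n + n - 1) (fun n => le_rfl) hq
    (fun n => (sourceAt_last (ha n) (h2 n)).symm)
  refine ⟨mkPath id (fun n => a n + n - 1) (fun n => le_rfl) hq
    (fun n => (sourceAt_last (ha n) (h2 n)).symm), fun n => ?_, fun y hy => ?_⟩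
  · rw [hr]
    have := hq n
    omega
  · have hr' (n : ℕ) : rk y n = a n + n - 1 := by have := hy n; omega
    refine path_ext (fun n => ?_) fun n => by rw [hr, hr']
    rw [vert_mkPath, vert_eq, hr', sourceAt_last (ha _) (h2 _), id]

lemma isVershikMap_vershik (h2 : ∀ n, 1 ≤ n → 2 ≤ a n) :
    (countableDiagram a ha).IsVershikMap (vershik h2) := by
  classical
  intro x hx
  rw [mem_maxPaths_iff, not_forall] at hx
  have hm := Nat.find_spec hx
  have hmin := fun {i} => Nat.find_min (m := i) hx
  set m := Nat.find hx
  have hM : MaxBelow x m := fun i hi => not_not.1 (hmin hi)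
  have hM' {i : ℕ} (hi : m < i) : ¬ MaxBelow x i := fun h => hm (h m hi)
  refine ⟨m, fun i hi => (isMax_iff x i).2 (hM i hi), mt (isMax_iff x m).1 hm,
    (covBy_iff x (succPath x) m).2 ⟨?_, ?_⟩,
    fun i hi => (isMin_iff (succPath x) i).2 ((minBelow_succPath x m).2 hM i hi),
    fun i hi => (edge_eq_iff (x := succPath x) (y := x)).2 ⟨?_, ?_⟩⟩
  · rw [vert_succPath, succVert_of_not (hM' (by omega))]
  · rw [rk_succPath, succRk, if_neg (hM' (by omega)), if_pos hM]
  · rw [vert_succPath, succVert_of_not (hM' (by omega))]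
  · rw [rk_succPath, succRk_of_not (hM' hi)]

lemma isSuccessor_unique {x y z : Path a ha} (hy : (countableDiagram a ha).IsSuccessor x y)
    (hz : (countableDiagram a ha).IsSuccessor x z) : y = z := by
  obtain ⟨m, h1, h2, h3, h4, h5⟩ := hy
  obtain ⟨m', h1', h2', h3', h4', h5'⟩ := hz
  obtain rfl : m = m' := by
    rcases lt_trichotomy m m' with h | h | h
    · exact absurd (h1' m h) h2
    · exact h
    · exact absurd (h1 m' h) h2'
  rw [covBy_iff] at h3 h3'
  have hr (i : ℕ) : rk y i = rk z i := by
    rcases lt_trichotomy i m with h | rfl | h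
    · rw [(isMin_iff y i).1 (h4 i h), (isMin_iff z i).1 (h4' i h)]
    · rw [h3.2, h3'.2]
    · rw [rk_eq_of_edge (h5 i h), rk_eq_of_edge (h5' i h)]
  refine path_ext (fun n => ?_) hr
  have hN : vert y (m + n + 1) = vert z (m + n + 1) := by
    rw [vert_eq_of_edge (h5 _ (by omega)), vert_eq_of_edge (h5' _ (by omega))]
  exact vert_eq_of_le hN (fun i _ => hr i) (by omega)

/-- The forward orbit of the minimal path is dense, and it never returns to the maximal path. -/
lemma dense_not_maxPaths (h2 : ∀ n, 1 ≤ n → 2 ≤ a n) :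
    Dense {x : Path a ha | x ∉ (countableDiagram a ha).maxPaths} := by
  obtain ⟨z, hz, -⟩ := existsUnique_maxPath (ha := ha) h2
  rw [mem_maxPaths_iff] at hz
  refine (dense_orbit h2 (succPath z)).mono ?_
  rintro _ ⟨k, rfl⟩ hk
  refine iterate_ne_self h2 z (Nat.succ_pos k) ?_
  rw [Function.iterate_succ_apply]
  exact (existsUnique_maxPath (ha := ha) h2).unique hk (mem_maxPaths_iff.2 hz)

lemma eq_vershik (h2 : ∀ n, 1 ≤ n → 2 ≤ a n) {ψ : Path a ha ≃ₜ Path a ha}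
    (hψ : (countableDiagram a ha).IsVershikMap ψ) : ψ = vershik h2 := by
  have := Continuous.ext_on (dense_not_maxPaths h2) ψ.continuous (vershik h2).continuous
    fun x hx => isSuccessor_unique (hψ x hx) (isVershikMap_vershik h2 x hx)
  exact DFunLike.coe_injective this

/-! ### The number of finite paths -/

lemma card_incoming (h0 : ∀ n, 0 < a n) (n : ℕ) (w : Fin (n + 2)) :
    Nat.card {e : CountableEdge a n // e.1 = w} = a n + n := by
  let f : {e : CountableEdge a n // e.1 = w} ≃ Fin (a n + n) :=
    { toFun := fun e => ⟨edgeRank e.1, edgeRank_lt (h0 n) e.1⟩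
      invFun := fun j => ⟨edgeAt n w j j.2, rfl⟩
      left_inv := fun e => by
        obtain ⟨e, rfl⟩ := e
        exact Subtype.ext (edgeAt_edgeRank (h0 n) e)
      right_inv := fun j => Fin.ext (edgeRank_edgeAt j.2) }
  rw [Nat.card_congr f, Nat.card_fin]

/-- Finiteness is part of the induction, as cardinalities of infinite types are zero by
convention. -/
lemma height_eq (n : ℕ) (v : (countableDiagram a ha).V n) :
    Finite ((countableDiagram a ha).PathTo n v) ∧
      (countableDiagram a ha).height n v = towerHeight a n := by
  induction n with
  | zero =>
    have h := OrderedBratteliDiagram.card_pathTo_zero _ v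
    exact ⟨Nat.finite_of_card_ne_zero (by rw [h]; exact one_ne_zero), h⟩
  | succ n ih =>
    have hfin (u) : Finite ((countableDiagram a ha).PathTo n u) := (ih u).1
    have e := OrderedBratteliDiagram.pathToSuccEquiv _ n v
    refine ⟨Finite.of_equiv _ e.symm, ?_⟩
    have := Fintype.ofFinite {e : (countableDiagram a ha).E n // (countableDiagram a ha).tgt e = v}
    have hc : Nat.card {e : (countableDiagram a ha).E n // (countableDiagram a ha).tgt e = v} =
      a n + n := card_incoming ha n v
    rw [OrderedBratteliDiagram.height, Nat.card_congr e, Nat.card_sigma]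
    have hu (u) : Nat.card ((countableDiagram a ha).PathTo n u) = towerHeight a n := (ih u).2
    rw [Finset.sum_congr rfl fun e _ => hu _, Finset.sum_const, Finset.card_univ,
      ← Nat.card_eq_fintype_card, hc, towerHeight_succ, smul_eq_mul, mul_comm]

/-! ### Topological entropy -/

/-- The entourage of the pairs of paths with the same first `N` edges. -/
def edgeEntourage (a : ℕ → ℕ) (ha : ∀ n, 0 < a n) (N : ℕ) : SetRel (Path a ha) (Path a ha) :=
  {p | ∀ i < N, p.1.1 i = p.2.1 i}

/-- The entourages `edgeEntourage a ha N` are a basis of the uniformity, which is induced from the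
product of the discrete uniformities. -/
lemma exists_edgeEntourage_subset {U : SetRel (Path a ha) (Path a ha)} (hU : U ∈ uniformity _) :
    ∃ N, edgeEntourage a ha N ⊆ U := by
  have hle : ⨅ N, 𝓟 (edgeEntourage a ha N) ≤ uniformity (Path a ha) := by
    have : uniformity (Path a ha) = comap (fun p : Path a ha × Path a ha => (p.1.1, p.2.1))
      (uniformity ((n : ℕ) → (countableDiagram a ha).E n)) := rfl
    rw [this, Pi.uniformity, comap_iInf]
    refine le_iInf fun i => ?_
    rw [comap_comap, ← map_le_iff_le_comap]
    refine (map_mono (iInf_le _ (i + 1))).trans ?_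
    change _ ≤ 𝓟 SetRel.id
    rw [map_principal, principal_mono]
    rintro _ ⟨p, hp, rfl⟩
    exact hp i (by omega)
  have hdir : Directed (· ≥ ·) fun N => 𝓟 (edgeEntourage a ha N) :=
    directed_of_isDirected_le fun M N hMN =>
      principal_mono.2 fun p hp i hi => hp i (by omega)
  obtain ⟨N, hN⟩ := (mem_iInf_of_directed hdir U).1 (hle hU)
  exact ⟨N, mem_principal.1 hN⟩

/-- The orbit segment of length `towerHeight a n` of `x`, seen up to level `n`, is determined by the
tower and the position of `x` and by the next tower that its orbit enters. -/
lemma iterate_edge_eq {x y : Path a ha} {n : ℕ} (hp : pos x n = pos y n)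
    (hv : vert x n = vert y n)
    (hv' : vert (succPath^[towerHeight a n] x) n = vert (succPath^[towerHeight a n] y) n)
    {k : ℕ} (hk : k < towerHeight a n) :
    ∀ i < n, (succPath^[k] x).1 i = (succPath^[k] y).1 i := by
  refine edge_eq_of_pos_eq ?_ (by rw [pos_iterate, pos_iterate, hp])
  rcases lt_or_ge (pos x n + k) (towerHeight a n) with h | h
  · rw [((iterate_of_lt h).2 n le_rfl).1, ((iterate_of_lt (hp ▸ h)).2 n le_rfl).1, hv]
  · have key (z : Path a ha) (hz : pos z n = pos x n) :
        vert (succPath^[k] z) n = vert (succPath^[towerHeight a n] z) n := by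
      have hlt := pos_lt z n
      have h1 : pos (succPath^[k] z) n + (towerHeight a n - k) < towerHeight a n := by
        rw [pos_iterate, Nat.mod_eq_sub_mod (by omega), Nat.mod_eq_of_lt (by omega)]
        omega
      rw [← ((iterate_of_lt h1).2 n le_rfl).1, ← Function.iterate_add_apply,
        Nat.sub_add_cancel hk.le]
    rw [key x rfl, key y hp.symm, hv']

/-- The number of orbit segments of length `towerHeight a n`, seen up to level `n`, is at most
`(4 * towerHeight a n) ^ 3`. -/
lemma coverEntropyEntourage_le (h2 : ∀ n, 1 ≤ n → 2 ≤ a n) {N n : ℕ} (hn : N ≤ n) :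
    Dynamics.coverEntropyEntourage (succPath : Path a ha → Path a ha) univ (edgeEntourage a ha N) ≤
      ((12 * (Real.log (4 * towerHeight a n) / (4 * towerHeight a n)) : ℝ) : EReal) := by
  have hH := towerHeight_pos ha n
  have : (edgeEntourage a ha N).IsSymm := ⟨fun x y h i hi => (h i hi).symm⟩
  obtain ⟨s, hs, hcard⟩ := exists_dynCover (ι := Fin (n + 1) × Fin (towerHeight a n) × Fin (n + 1))
    (succPath : Path a ha → Path a ha) (edgeEntourage a ha N) (towerHeight a n)
    (fun x => (⟨vert x n, Nat.lt_succ_of_le (vert_le x n)⟩, ⟨pos x n, pos_lt x n⟩,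
      ⟨vert (succPath^[towerHeight a n] x) n, Nat.lt_succ_of_le (vert_le _ n)⟩))
    (fun x y h => by
      simp only [Prod.mk.injEq, Fin.mk.injEq] at h
      rw [Dynamics.mem_dynEntourage]
      exact fun k hk i hi => iterate_edge_eq h.2.1 h.1 h.2.2 hk i (by omega))
  have hsn : 0 < s.card := by
    obtain ⟨x, -⟩ := exists_path_vert_eq (a := a) (ha := ha) (n := 0) (v := 0) le_rfl
    obtain ⟨y, hy, -⟩ := hs (mem_univ x)
    exact Finset.card_pos.2 ⟨y, hy⟩
  -- A cover for an entourage `U` bounds the entropy of `U ○ U`, which is `U` itself here, since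
  -- agreement of the first `N` edges is an equivalence relation.
  refine (Dynamics.coverEntropyEntourage_antitone _ _ fun p hp => ?_).trans
    ((hs.coverEntropyEntourage_le_log_card_div (mapsTo_univ _ _) hH.ne').trans ?_)
  · obtain ⟨y, h1, h3⟩ := hp
    exact fun i hi => (h1 i hi).trans (h3 i hi)
  have hlog : ENNReal.log (s.card : ENNReal) = ((Real.log s.card : ℝ) : EReal) := by
    rw [← ENNReal.ofReal_natCast, ENNReal.log_ofReal_of_pos (by exact_mod_cast hsn)]
  have hcoe : ((towerHeight a n : ℕ) : EReal) = ((towerHeight a n : ℝ) : EReal) := rfl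
  rw [hlog, hcoe, ← EReal.coe_div, EReal.coe_le_coe_iff]
  have hle : (s.card : ℝ) ≤ (4 * towerHeight a n) ^ 3 := by
    have h4 : s.card ≤ (n + 1) * (towerHeight a n * (n + 1)) := by simpa using hcard
    have h5 : n + 1 ≤ 2 * towerHeight a n := by have := le_towerHeight ha h2 n; omega
    have h6 : s.card ≤ (4 * towerHeight a n) ^ 3 :=
      calc s.card ≤ (n + 1) * (towerHeight a n * (n + 1)) := h4
        _ ≤ (2 * towerHeight a n) * (towerHeight a n * (2 * towerHeight a n)) := by gcongr
        _ ≤ (4 * towerHeight a n) ^ 3 := by nlinarith [pow_pos hH 3]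
    exact_mod_cast h6
  have hH' : (0 : ℝ) < towerHeight a n := by exact_mod_cast hH
  have h7 : Real.log s.card ≤ 3 * Real.log (4 * towerHeight a n) := by
    refine (Real.log_le_log (by exact_mod_cast hsn) hle).trans ?_
    rw [Real.log_pow]
    norm_num
  rw [div_le_iff₀ hH']
  refine h7.trans (le_of_eq ?_)
  field_simp
  ring

lemma coverEntropy_succPath (h2 : ∀ n, 1 ≤ n → 2 ≤ a n) :
    Dynamics.coverEntropy (succPath : Path a ha → Path a ha) univ = 0 := by
  obtain ⟨x, -⟩ := exists_path_vert_eq (a := a) (ha := ha) (n := 0) (v := 0) le_rfl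
  refine le_antisymm (iSup₂_le fun U hU => ?_)
    (Dynamics.coverEntropy_nonneg _ ⟨x, mem_univ x⟩)
  obtain ⟨N, hN⟩ := exists_edgeEntourage_subset hU
  refine (Dynamics.coverEntropyEntourage_antitone _ _ hN).trans ?_
  have hlim : Tendsto (fun n => 12 * (Real.log (4 * towerHeight a n) / (4 * towerHeight a n)))
      atTop (𝓝 0) := by
    have h1 : Tendsto (fun n => (4 * towerHeight a n : ℝ)) atTop atTop :=
      (tendsto_natCast_atTop_atTop.comp (tendsto_towerHeight ha h2)).const_mul_atTop (by norm_num)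
    simpa using (Real.isLittleO_log_id_atTop.tendsto_div_nhds_zero.comp h1).const_mul 12
  have hlim' := (continuous_coe_real_ereal.tendsto 0).comp hlim
  exact ge_of_tendsto hlim' (eventually_atTop.2 ⟨N, fun n hn => coverEntropyEntourage_le h2 hn⟩)

/-! ### The words of the towers -/

/-- The edges into a vertex, in increasing order, are met by the orbit of a path that starts at the
base of the tower. -/
lemma incoming_eq {n : ℕ} {x : Path a ha} (hx : rk x n = 0) :
    (countableDiagram a ha).incoming ((countableDiagram a ha).src (x.1 (n + 1))) =
      (List.range (a n + n)).map fun j => (succPath^[j * towerHeight a n] x).1 n := by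
  have hr (j : ℕ) (hj : j < a n + n) : rk (succPath^[j * towerHeight a n] x) n = j ∧
      vert (succPath^[j * towerHeight a n] x) (n + 1) = vert x (n + 1) := by
    obtain ⟨-, h1, h2⟩ := iterate_mul_towerHeight (x := x) (n := n) (j := j) (by omega)
    exact ⟨by omega, (h2 (n + 1) (by omega)).1⟩
  refine List.Perm.eq_of_pairwise (le := (· ≤ ·)) (fun _ _ _ _ => le_antisymm)
    (OrderedBratteliDiagram.pairwise_incoming _ _) ?_ ?_
  · refine List.pairwise_map.2 ((List.pairwise_lt_range).imp_of_mem fun {i j} hi hj hij => ?_)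
    rw [List.mem_range] at hi hj
    refine (edge_le_iff _ _).2
      ⟨Fin.ext ((tgt_eq_vert _ _).trans (Eq.trans ?_ (tgt_eq_vert _ _).symm)), ?_⟩
    · rw [(hr i hi).2, (hr j hj).2]
    · change rk _ n ≤ rk _ n
      rw [(hr i hi).1, (hr j hj).1]
      exact hij.le
  · refine (List.perm_ext_iff_of_nodup (OrderedBratteliDiagram.nodup_incoming _ _) ?_).2 fun e => ?_
    · refine List.nodup_range.map_on fun i hi j hj h => ?_
      rw [List.mem_range] at hi hj
      rw [← (hr i hi).1, ← (hr j hj).1, rk_eq_of_edge h]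
    · rw [OrderedBratteliDiagram.mem_incoming, List.mem_map]
      constructor
      · intro he
        have hj := edgeRank_lt (ha n) e
        refine ⟨edgeRank (a := a) e, List.mem_range.2 hj, ?_⟩
        refine edge_ext (ha n) (Fin.ext ((tgt_eq_vert _ _).trans ?_)) (hr _ hj).1
        rw [(hr _ hj).2]
        exact congrArg Fin.val he.symm
      · rintro ⟨j, hj, rfl⟩
        rw [List.mem_range] at hj
        exact Fin.ext ((tgt_eq_vert _ _).trans (hr j hj).2)

/-- The first edges of the orbit of `x` along its tower of level `n + 1` form the word of the
tower. -/
lemma composedWord_eq (n : ℕ) {x : Path a ha} (hx : pos x (n + 1) = 0) :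
    composedWord (countableDiagram a ha).substitution (n + 1)
      ((countableDiagram a ha).src (x.1 (n + 1))) =
      (List.range (towerHeight a (n + 1))).map fun k => (succPath^[k] x).1 0 := by
  have hr : rk x n = 0 := pos_eq_zero_iff.1 hx n (by omega)
  induction n generalizing x with
  | zero =>
    refine (OrderedBratteliDiagram.composedWord_one _ _).trans ?_
    rw [incoming_eq hr]
    simp only [List.flatMap_singleton', towerHeight_succ, towerHeight_zero, mul_one, one_mul]
    rfl
  | succ n ih =>
    refine (OrderedBratteliDiagram.composedWord_add_two _ _ _).trans ?_
    rw [incoming_eq hr, List.flatMap_map, towerHeight_succ (n + 1)]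
    refine Eq.trans ?_
      (flatMap_range_map_range (fun k => (succPath^[k] x).1 0) _ (towerHeight a (n + 1)))
    refine List.flatMap_congr fun j hj => ?_
    rw [List.mem_range] at hj
    have h1 := (iterate_mul_towerHeight (x := x) (n := n + 1) (j := j) (by omega)).1
    have h0 : pos x (n + 1) = 0 :=
      pos_eq_zero_iff.2 fun i hi => pos_eq_zero_iff.1 hx i (by omega)
    rw [h0] at h1
    refine (ih h1 (pos_eq_zero_iff.1 h1 n (by omega))).trans ?_
    simp only [Function.iterate_add_apply]
    rfl

/-! ### Recognizability -/

/-- The words of sources read on the diagram are determined by the parities of their letters. The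
only two vertices with the same parities are `n - 1` and `n + 1` for `a n = 2`. They have the same
parity, and their words coincide. -/
lemma sourceAt_eq_of_parity {n w w' : ℕ} (h1 : 1 ≤ n) (h2 : 2 ≤ a n) (hw : w ≤ n + 1)
    (hw' : w' ≤ n + 1)
    (h : ∀ j < a n + n, sourceAt a n w j % 2 = sourceAt a n w' j % 2) :
    w % 2 = w' % 2 ∧ ∀ j < a n + n, sourceAt a n w j = sourceAt a n w' j := by
  wlog hle : w ≤ w' generalizing w w'
  · obtain ⟨h3, h4⟩ := this hw' hw (fun j hj => (h j hj).symm) (by omega)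
    exact ⟨h3.symm, fun j hj => (h4 j hj).symm⟩
  rcases eq_or_lt_of_le hle with rfl | hlt
  · exact ⟨rfl, fun _ _ => rfl⟩
  have hcase : w + 1 = n ∧ w' = n + 1 ∧ a n = 2 := by
    by_cases hw'' : w' ≤ n ∨ w + 1 < n
    · have := h (w + 1) (by omega)
      unfold sourceAt at this
      split_ifs at this <;> omega
    · by_cases hwn : w = n
      · have := h n (by omega)
        unfold sourceAt at this
        split_ifs at this <;> omega
      · refine ⟨by omega, by omega, ?_⟩
        by_contra h3
        have := h (n + 1) (by omega)
        unfold sourceAt at this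
        split_ifs at this <;> omega
  obtain ⟨h3, h4, h5⟩ := hcase
  refine ⟨by omega, fun j hj => ?_⟩
  unfold sourceAt
  split_ifs <;> omega

/-- The vertices `0` and `n` are the first and the last letter of every word of sources. For `d ≥ 1`
some word differs from this in parity: its letter of index `d` is odd, or `n` is even and its letter
of index `d - 1` is odd. -/
lemma exists_sourceAt_odd {n d : ℕ} (h1 : 1 ≤ n) (h2 : 2 ≤ a n) (hd : 1 ≤ d) (hd' : d < a n + n) :
    ∃ w ≤ n, sourceAt a n w d % 2 = 1 ∨ (n % 2 = 0 ∧ sourceAt a n w (d - 1) % 2 = 1) := by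
  by_cases h3 : d ≤ n
  · refine ⟨if d % 2 = 1 then d else d - 1, by split_ifs <;> omega, Or.inl ?_⟩
    unfold sourceAt
    split_ifs <;> omega
  · refine ⟨if n % 2 = 1 then n else n - 1, by split_ifs <;> omega, ?_⟩
    unfold sourceAt
    split_ifs <;> omega

/-- The two-sided sequence of the first edges along the orbit of `x`. -/
noncomputable def code (h2 : ∀ n, 1 ≤ n → 2 ≤ a n) (x : Path a ha) :
    ℤ → (countableDiagram a ha).Alphabet 0 := fun k => ((vershik h2 ^ k) x).1 0

lemma vershik_pow_apply (h2 : ∀ n, 1 ≤ n → 2 ≤ a n) (k : ℕ) (x : Path a ha) :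
    (vershik h2 ^ (k : ℤ)) x = succPath^[k] x := by
  induction k with
  | zero => rfl
  | succ k ih =>
    rw [Function.iterate_succ_apply', ← ih, Nat.cast_succ, add_comm, zpow_add, zpow_one]
    rfl

lemma code_vershik_zpow (h2 : ∀ n, 1 ≤ n → 2 ≤ a n) (j : ℤ) (x : Path a ha) (k : ℤ) :
    code h2 ((vershik h2 ^ j) x) k = code h2 x (k + j) := by
  rw [code, code, zpow_add]
  rfl

lemma code_natCast (h2 : ∀ n, 1 ≤ n → 2 ≤ a n) (x : Path a ha) (k : ℕ) :
    code h2 x k = (succPath^[k] x).1 0 := by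
  rw [code, vershik_pow_apply]

lemma code_congr_iterate {h2 : ∀ n, 1 ≤ n → 2 ≤ a n} {x y : Path a ha}
    (h : code h2 x = code h2 y) (k : ℕ) :
    code h2 (succPath^[k] x) = code h2 (succPath^[k] y) := by
  ext1 i
  rw [← vershik_pow_apply h2, ← vershik_pow_apply h2, code_vershik_zpow, code_vershik_zpow, h]

/-- Two paths with the same code can be moved back to the base of the tower of one of them. -/
lemma exists_base {h2 : ∀ n, 1 ≤ n → 2 ≤ a n} {x y : Path a ha} (h : code h2 x = code h2 y)
    (n : ℕ) : ∃ x' y' : Path a ha, code h2 x' = code h2 y' ∧ pos x' n = 0 ∧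
      succPath^[pos x n] x' = x ∧ succPath^[pos x n] y' = y := by
  have hk (z : Path a ha) :
      succPath^[pos x n] ((vershik h2 ^ (-(pos x n : ℤ))) z) = z := by
    rw [← vershik_pow_apply h2, zpow_neg]
    exact Homeomorph.apply_symm_apply (vershik h2 ^ (pos x n : ℤ)) z
  refine ⟨(vershik h2 ^ (-(pos x n : ℤ))) x, (vershik h2 ^ (-(pos x n : ℤ))) y, ?_, ?_, hk x, hk y⟩
  · ext1 i
    rw [code_vershik_zpow, code_vershik_zpow, h]
  · have h1 := pos_iterate ((vershik h2 ^ (-(pos x n : ℤ))) x) n (pos x n)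
    rw [hk] at h1
    have h3 := pos_lt x n
    have h4 := pos_lt ((vershik h2 ^ (-(pos x n : ℤ))) x) n
    rcases lt_or_ge (pos ((vershik h2 ^ (-(pos x n : ℤ))) x) n + pos x n) (towerHeight a n)
      with h5 | h5
    · rw [Nat.mod_eq_of_lt h5] at h1
      omega
    · rw [Nat.mod_eq_sub_mod h5, Nat.mod_eq_of_lt (by omega)] at h1
      omega

/-- If the code determines the position at level `n` and the parity of the vertex of level `n`, then
it determines the position at level `n + 1` and the word of the sources of the edges into the vertex
of level `n + 1`. At the base of every tower of level `n + 1`, the vertex of level `n` is `0`, and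
just before it was `n`. At a rank other than `0`, in some tower of level `n + 1`, this fails for the
parities, and every orbit enters this tower. -/
lemma recognizability_step (h2 : ∀ n, 1 ≤ n → 2 ≤ a n) {n : ℕ} (hn : 1 ≤ n)
    (ih : ∀ x y : Path a ha, code h2 x = code h2 y →
      pos x n = pos y n ∧ vert x n % 2 = vert y n % 2)
    {x y : Path a ha} (h : code h2 x = code h2 y) :
    pos x (n + 1) = pos y (n + 1) ∧ vert x (n + 1) % 2 = vert y (n + 1) % 2 ∧
      ∀ j < a n + n, sourceAt a n (vert x (n + 1)) j = sourceAt a n (vert y (n + 1)) j := by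
  obtain ⟨x', y', h', hx', hx, hy⟩ := exists_base h (n + 1)
  have hxn : pos x' n = 0 := by rw [← pos_mod, hx', Nat.zero_mod]
  have hyn : pos y' n = 0 := by rw [← (ih x' y' h').1, hxn]
  have hHn := towerHeight_pos ha n
  have hd' := rk_lt y' n
  have hpy : pos y' (n + 1) = rk y' n * towerHeight a n := by rw [pos_succ, hyn, zero_add]
  have hd : rk y' n = 0 := by
    by_contra hd
    obtain ⟨w, hw, hodd | ⟨heven, hodd⟩⟩ :=
      exists_sourceAt_odd hn (h2 n hn) (Nat.one_le_iff_ne_zero.2 hd) hd'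
    · -- After a time divisible by the height, the orbit of `x'` is at a base, hence at the even
      -- vertex `0`, while that of `y'` is at an odd vertex.
      have hlt := pos_lt y' (n + 1)
      obtain ⟨t, ht1, ht2⟩ := exists_iterate_vert_eq h2 y' (n := n + 1) (v := w)
        (k := pos y' (n + 1)) (by omega) hlt
      have ht3 : t % towerHeight a (n + 1) = 0 := by
        rw [pos_iterate] at ht2
        have : pos y' (n + 1) + t ≡ pos y' (n + 1) + 0 [MOD towerHeight a (n + 1)] := by
          rw [Nat.ModEq, ht2, add_zero, Nat.mod_eq_of_lt hlt]
        simpa [Nat.ModEq] using Nat.ModEq.add_left_cancel' _ this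
      have hpar := (ih _ _ (code_congr_iterate h' t)).2
      rw [vert_eq, vert_eq (succPath^[t] y'), ht1, ← pos_div, ← pos_div, ht2, pos_div y',
        pos_iterate, hx', zero_add, ht3, Nat.zero_div, hodd,
        sourceAt_zero (ha n) (vert_le _ _)] at hpar
      omega
    · -- One subtower earlier, the orbit of `x'` is in the last subtower of its tower, hence at the
      -- even vertex `n`, while that of `y'` is at an odd vertex.
      have hlt : (rk y' n - 1) * towerHeight a n < towerHeight a (n + 1) := by
        rw [towerHeight_succ]
        have : rk y' n - 1 < a n + n := by omega
        nlinarith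
      obtain ⟨t, ht1, ht2⟩ := exists_iterate_vert_eq h2 y' (n := n + 1) (v := w)
        (k := (rk y' n - 1) * towerHeight a n) (by omega) hlt
      obtain ⟨e, he⟩ : ∃ e, rk y' n = e + 1 := ⟨rk y' n - 1, by omega⟩
      have hq : towerHeight a n ≤ towerHeight a (n + 1) := by
        rw [towerHeight_succ]
        nlinarith
      have ht3 : t % towerHeight a (n + 1) = towerHeight a (n + 1) - towerHeight a n := by
        rw [pos_iterate, hpy, he, Nat.add_sub_cancel] at ht2
        have h3 : e * towerHeight a n + (towerHeight a n + t) ≡ e * towerHeight a n + 0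
            [MOD towerHeight a (n + 1)] := by
          rw [Nat.ModEq, add_zero, ← add_assoc, ← Nat.succ_mul, ht2, Nat.mod_eq_of_lt]
          rwa [he, Nat.add_sub_cancel] at hlt
        have h4 := Nat.ModEq.add_left_cancel' _ h3
        refine Nat.ModEq.eq_of_lt_of_lt (m := towerHeight a (n + 1)) ?_
          (Nat.mod_lt _ (towerHeight_pos ha _)) (Nat.sub_lt (towerHeight_pos ha _) hHn)
        refine (Nat.mod_modEq _ _).trans (Nat.ModEq.add_left_cancel' (towerHeight a n) ?_)
        rw [Nat.add_sub_cancel' hq]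
        exact h4.trans (by simp [Nat.ModEq])
      have hpar := (ih _ _ (code_congr_iterate h' t)).2
      have hlast : (towerHeight a (n + 1) - towerHeight a n) / towerHeight a n = a n + n - 1 := by
        rw [towerHeight_succ, ← Nat.mul_sub_one, Nat.mul_div_cancel_left _ hHn]
      rw [vert_eq, vert_eq (succPath^[t] y'), ht1, ← pos_div, ← pos_div, ht2,
        Nat.mul_div_cancel _ hHn, pos_iterate, hx', zero_add, ht3, hlast, hodd,
        sourceAt_last (ha n) (h2 n)] at hpar
      omega
  rw [hd, zero_mul] at hpy
  have hlt : pos x (n + 1) < towerHeight a (n + 1) := pos_lt x _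
  have hx1 := iterate_of_lt (x := x') (n := n + 1) (k := pos x (n + 1)) (by omega)
  have hy1 := iterate_of_lt (x := y') (n := n + 1) (k := pos x (n + 1)) (by omega)
  rw [hx] at hx1
  rw [hy] at hy1
  refine ⟨by omega, ?_⟩
  rw [(hx1.2 _ le_rfl).1, (hy1.2 _ le_rfl).1]
  refine sourceAt_eq_of_parity hn (h2 n hn) (vert_le _ _) (vert_le _ _) fun j hj => ?_
  have hrx : rk x' n = 0 := by rw [← pos_div, hx', Nat.zero_div]
  have hx3 := iterate_mul_towerHeight (x := x') (n := n) (j := j) (by omega)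
  have hy3 := iterate_mul_towerHeight (x := y') (n := n) (j := j) (by omega)
  have hpar := (ih _ _ (code_congr_iterate h' (j * towerHeight a n))).2
  rw [vert_eq, vert_eq (succPath^[_] y'), hx3.2.1, hy3.2.1, (hx3.2.2 _ (by omega)).1,
    (hy3.2.2 _ (by omega)).1, hrx, hd, zero_add] at hpar
  exact hpar

lemma code_injective (h2 : ∀ n, 1 ≤ n → 2 ≤ a n) :
    Function.Injective (code h2 : Path a ha → ℤ → (countableDiagram a ha).Alphabet 0) := by
  have key (n : ℕ) : ∀ x y : Path a ha, code h2 x = code h2 y →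
      pos x (n + 1) = pos y (n + 1) ∧ vert x (n + 1) % 2 = vert y (n + 1) % 2 := by
    induction n with
    | zero =>
      intro x y h
      obtain ⟨h1, h3⟩ := (edge_eq_iff (x := x) (y := y)).1 (congrFun h 0)
      rw [h1, pos_succ, pos_succ, h3]
      exact ⟨rfl, rfl⟩
    | succ n ih =>
      intro x y h
      obtain ⟨h1, h3, -⟩ := recognizability_step h2 (by omega) ih h
      exact ⟨h1, h3⟩
  intro x y h
  have hr (n : ℕ) : rk x n = rk y n := rk_eq_of_pos_eq (key n x y h).1 n (by omega)
  refine path_ext (fun n => ?_) hr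
  rw [vert_eq x, vert_eq y, ← hr]
  exact (recognizability_step h2 (by omega) (key n) h).2.2 _ (rk_lt x _)

/-! ### The conjugacy with the subshift -/

lemma continuous_code (h2 : ∀ n, 1 ≤ n → 2 ≤ a n) : Continuous (code (ha := ha) h2) :=
  continuous_pi fun k =>
    (continuous_of_dependsOn
      (f := fun x : Path a ha => (x.1 0 : (countableDiagram a ha).Alphabet 0)) 1
      fun _ _ h => h 0 one_pos).comp (vershik h2 ^ k).continuous

lemma isClosedEmbedding_code (h2 : ∀ n, 1 ≤ n → 2 ≤ a n) :
    IsClosedEmbedding (code (ha := ha) h2) :=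
  (continuous_code h2).isClosedEmbedding (code_injective h2)

/-- The word of a tower is read along the orbit of any path at the base of this tower. -/
lemma exists_composedWord_eq (h2 : ∀ n, 1 ≤ n → 2 ≤ a n) (n : ℕ)
    (v : (countableDiagram a ha).Alphabet (n + 1)) :
    ∃ x : Path a ha, pos x (n + 1) = 0 ∧
      composedWord (countableDiagram a ha).substitution (n + 1) v =
        (List.range (towerHeight a (n + 1))).map fun k : ℕ => code h2 x k := by
  obtain ⟨x, hx, hx'⟩ := exists_path_vert_eq (a := a) (ha := ha)
    (Nat.lt_succ_iff.1 (Fin.is_lt (n := n + 2) v))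
  refine ⟨x, hx', ?_⟩
  have hv : v = (countableDiagram a ha).src (x.1 (n + 1)) := Fin.ext (n := n + 2) hx.symm
  subst hv
  rw [composedWord_eq n hx']
  simp only [code_natCast]
  rfl

lemma range_code_subset (h2 : ∀ n, 1 ≤ n → 2 ≤ a n)
    (c : (n : ℕ) → (countableDiagram a ha).Alphabet n) :
    range (code h2) ⊆ sAdicSubshift (countableDiagram a ha).substitution c := by
  rintro _ ⟨x, rfl⟩ i k
  set z := (vershik h2 ^ i) x with hz
  have hopen : IsOpen {y : Path a ha | ∀ j < k, code h2 y j = code h2 z j} := by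
    have : {y : Path a ha | ∀ j < k, code h2 y j = code h2 z j} =
        ⋂ j ∈ Finset.range k, (fun y => code h2 y (j : ℕ)) ⁻¹' {code h2 z (j : ℕ)} := by
      ext y; simp
    rw [this]
    exact isOpen_biInter_finset fun j _ => (isOpen_discrete _).preimage
      ((continuous_apply _).comp (continuous_code h2))
  obtain ⟨N, hN⟩ := exists_cylinder_subset hopen (x := z) (fun j _ => rfl)
  -- The tower of `z` of level `N + k` occurs in the first subtower of level `N + k + 1` of every
  -- tower of level `N + k + 2`, and a window of length `k` from there stays in the latter tower.
  obtain ⟨b, hb, hword⟩ := exists_composedWord_eq h2 (N + k + 1) (c (N + k + 2))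
  obtain ⟨j, hj, hjv⟩ := exists_sourceAt_eq ha h2 (vert b (N + k + 1)) (vert_le z (N + k))
  have hb' : pos b (N + k + 1) = 0 := by rw [← pos_mod, hb, Nat.zero_mod]
  have hp := pos_lt z (N + k)
  have hlt : pos z (N + k) + j * towerHeight a (N + k) < towerHeight a (N + k + 1) := by
    rw [towerHeight_succ]
    nlinarith
  obtain ⟨h3, h4⟩ := iterate_of_lt (x := b) (n := N + k + 1)
    (k := pos z (N + k) + j * towerHeight a (N + k)) (by omega)
  set t := pos z (N + k) + j * towerHeight a (N + k) with ht
  have hmem := hN fun i hi => edge_eq_of_pos_eq (x := succPath^[t] b) (y := z) (n := N + k) (by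
    rw [vert_eq, (h4 _ le_rfl).1, ← pos_div, h3, hb', zero_add, ht,
      Nat.add_mul_div_right _ _ (towerHeight_pos ha _), Nat.div_eq_of_lt hp, zero_add, hjv]) (by
    rw [← pos_mod, h3, hb', zero_add, ht, Nat.add_mul_mod_self_right, Nat.mod_eq_of_lt hp])
    i (by omega)
  refine ⟨N + k + 2, ?_⟩
  rw [hword]
  have hle : t + k ≤ towerHeight a (N + k + 2) := by
    have h5 := le_towerHeight ha h2 (N + k + 1)
    have h6 := h2 (N + k + 1) (by omega)
    rw [towerHeight_succ (N + k + 1)]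
    nlinarith
  convert ofFn_isInfix_map_range (F := fun m : ℕ => code h2 b m) hle using 2
  ext1 j
  have h7 := hmem j j.2
  rw [← vershik_pow_apply h2, code_vershik_zpow, hz, code_vershik_zpow] at h7
  rw [add_comm i, ← h7]
  push_cast
  rw [add_comm]

lemma subset_range_code (h2 : ∀ n, 1 ≤ n → 2 ≤ a n)
    (c : (n : ℕ) → (countableDiagram a ha).Alphabet n) :
    sAdicSubshift (countableDiagram a ha).substitution c ⊆ range (code h2) := by
  intro y hy
  let C (K : ℕ) : Set (Path a ha) := {x | ∀ i : ℤ, -K ≤ i → i ≤ K → code h2 x i = y i}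
  have hclosed (K : ℕ) : IsClosed (C K) := by
    have : C K = ⋂ i ∈ Set.Icc (-K : ℤ) K, (fun x => code h2 x i) ⁻¹' {y i} := by
      ext x; simp [C]
    rw [this]
    exact isClosed_biInter fun i _ => (isClosed_discrete _).preimage
      ((continuous_apply _).comp (continuous_code h2))
  have hne (K : ℕ) : (C K).Nonempty := by
    -- The window has a letter more than needed, so that it does not fit into the word of level `0`.
    obtain ⟨n, hn⟩ := hy (-K) (2 * K + 2)
    obtain ⟨n, rfl⟩ : ∃ m, n = m + 1 := by
      refine Nat.exists_eq_succ_of_ne_zero ?_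
      rintro rfl
      have := hn.length_le
      simp [composedWord] at this
    obtain ⟨b, -, hword⟩ := exists_composedWord_eq h2 n (c (n + 1))
    rw [hword] at hn
    obtain ⟨t, -, ht⟩ := exists_of_ofFn_isInfix_map_range hn
    refine ⟨(vershik h2 ^ (t + K : ℤ)) b, fun i hi hi' => ?_⟩
    obtain ⟨j, hj⟩ := Int.eq_ofNat_of_zero_le (by omega : 0 ≤ i + K)
    have := ht ⟨j, by omega⟩
    rw [code_vershik_zpow]
    convert this.symm using 2
    · push_cast
      omega
    · dsimp only
      omega
  obtain ⟨x, hx⟩ := IsCompact.nonempty_iInter_of_sequence_nonempty_isCompact_isClosed C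
    (fun K x hx i hi hi' => hx i (by push_cast; omega) (by push_cast; omega)) hne
    (hclosed 0).isCompact hclosed
  refine ⟨x, funext fun i => ?_⟩
  exact mem_iInter.1 hx i.natAbs i (by omega) (by omega)

lemma range_code (h2 : ∀ n, 1 ≤ n → 2 ≤ a n)
    (c : (n : ℕ) → (countableDiagram a ha).Alphabet n) :
    range (code h2) = sAdicSubshift (countableDiagram a ha).substitution c :=
  (range_code_subset h2 c).antisymm (subset_range_code h2 c)

lemma leftShift_code (h2 : ∀ n, 1 ≤ n → 2 ≤ a n) (x : Path a ha) :
    leftShift (code h2 x) = code h2 (vershik h2 x) :=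
  funext fun k => (code_vershik_zpow h2 1 x k).symm

lemma leftShift_iterate_code (h2 : ∀ n, 1 ≤ n → 2 ≤ a n) (x : Path a ha) (k : ℕ) :
    leftShift^[k] (code h2 x) = code h2 (succPath^[k] x) := by
  induction k with
  | zero => rfl
  | succ k ih => rw [Function.iterate_succ_apply', Function.iterate_succ_apply', ih,
      leftShift_code, vershik_apply]

/-- The minimal path is regularly recurrent: it returns to its cylinder of level `n` at all
multiples of the height of level `n + 1`. -/
lemma isRegularlyRecurrent_code (h2 : ∀ n, 1 ≤ n → 2 ≤ a n) {x : Path a ha}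
    (hx : ∀ n, rk x n = 0) : IsRegularlyRecurrent leftShift (code h2 x) := by
  intro U hU
  obtain ⟨V, hVU, hV, hxV⟩ := mem_nhds_iff.1 hU
  obtain ⟨N, hN⟩ := exists_cylinder_subset (hV.preimage (continuous_code h2)) (x := x) hxV
  have hv (y : Path a ha) (hy : rk y N = 0) : vert y N = 0 := by
    rw [vert_eq, hy, sourceAt_zero (ha N) (vert_le y _)]
  refine ⟨towerHeight a (N + 1), towerHeight_pos ha _, fun k => hVU ?_⟩
  rw [leftShift_iterate_code]
  have h0 : pos x (N + 1) = 0 := pos_eq_zero_iff.2 fun i _ => hx i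
  have h1 : pos (succPath^[k * towerHeight a (N + 1)] x) (N + 1) = 0 := by
    rw [pos_iterate, h0, zero_add, Nat.mul_mod_left]
  rw [pos_eq_zero_iff] at h1
  refine hN (edge_eq_of_pos_eq ?_ (pos_congr fun i hi => ?_))
  · rw [hv _ (h1 N (by omega)), hv x (hx N)]
  · rw [h1 i (by omega), hx]

lemma isToeplitzSystem (h2 : ∀ n, 1 ≤ n → 2 ≤ a n)
    (c : (n : ℕ) → (countableDiagram a ha).Alphabet n) :
    IsToeplitzSystem (sAdicSubshift (countableDiagram a ha).substitution c) := by
  obtain ⟨x, hx, -⟩ := existsUnique_minPath (a := a) (ha := ha)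
  rw [mem_minPaths_iff] at hx
  refine ⟨code h2 x, isRegularlyRecurrent_code h2 hx, ?_, ?_⟩
  · rintro ⟨k, hk, hper⟩
    rw [Function.IsPeriodicPt, Function.IsFixedPt, leftShift_iterate_code] at hper
    exact iterate_ne_self h2 x hk (code_injective h2 hper)
  · have hrange : (range fun (k : ℤ) (i : ℤ) => code h2 x (i + k)) =
        code h2 '' range fun k : ℤ => (vershik h2 ^ k) x := by
      rw [← range_comp]
      congr 1
      ext k i
      exact (code_vershik_zpow h2 k x i).symm
    have hdense : Dense (range fun k : ℤ => (vershik h2 ^ k) x) := by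
      refine (dense_orbit h2 x).mono ?_
      rintro _ ⟨k, rfl⟩
      exact ⟨k, vershik_pow_apply h2 k x⟩
    rw [hrange, (isClosedEmbedding_code h2).closure_image_eq, hdense.closure_eq, image_univ,
      range_code]

lemma exists_conjugacy (h2 : ∀ n, 1 ≤ n → 2 ≤ a n)
    (c : (n : ℕ) → (countableDiagram a ha).Alphabet n) :
    ∃ h : Path a ha ≃ₜ sAdicSubshift (countableDiagram a ha).substitution c,
      ∀ x, (h (vershik h2 x) : ℤ → (countableDiagram a ha).Alphabet 0) = leftShift (h x) :=
  ⟨(isClosedEmbedding_code h2).isEmbedding.toHomeomorph.trans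
    (Homeomorph.setCongr (range_code h2 c)), fun x => (leftShift_code h2 x).symm⟩

/-! ### Cylinders and invariant measures -/

/-- The paths with the same first `N` edges as `x`. -/
def cylinder (x : Path a ha) (N : ℕ) : Set (Path a ha) := {y | ∀ i < N, y.1 i = x.1 i}

lemma borel_eq_generateFrom_cylinder :
    borel (Path a ha) = MeasurableSpace.generateFrom {s | ∃ x N, s = cylinder x N} := by
  refine TopologicalSpace.IsTopologicalBasis.borel_eq_generateFrom
    (TopologicalSpace.isTopologicalBasis_of_isOpen_of_nhds ?_ ?_)
  · rintro _ ⟨x, N, rfl⟩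
    exact isOpen_cylinder x N
  · intro x U hx hU
    obtain ⟨N, hN⟩ := exists_cylinder_subset hU hx
    exact ⟨_, ⟨x, N, rfl⟩, fun _ _ => rfl, hN⟩

lemma isPiSystem_cylinder : IsPiSystem {s : Set (Path a ha) | ∃ x N, s = cylinder x N} := by
  rintro _ ⟨x, N, rfl⟩ _ ⟨y, M, rfl⟩ ⟨z, hz, hz'⟩
  refine ⟨z, max N M, ?_⟩
  ext u
  constructor
  · rintro ⟨h, h'⟩ i hi
    rcases lt_max_iff.1 hi with hi | hi
    · rw [h i hi, hz i hi]
    · rw [h' i hi, hz' i hi]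
  · intro h
    exact ⟨fun i hi => by rw [h i (lt_max_of_lt_left hi), hz i hi],
      fun i hi => by rw [h i (lt_max_of_lt_right hi), hz' i hi]⟩

lemma isClopen_cylinder (x : Path a ha) (N : ℕ) : IsClopen (cylinder x N) := by
  refine ⟨?_, isOpen_cylinder x N⟩
  have : cylinder x N = ⋂ i, ⋂ (_ : i < N), (fun y : Path a ha => y.1 i) ⁻¹' {x.1 i} := by
    ext y; simp [cylinder]
  rw [this]
  exact isClosed_biInter fun i _ => (isClosed_discrete _).preimage (continuous_edge i)

lemma continuous_pos (n : ℕ) : Continuous fun x : Path a ha => pos x n :=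
  continuous_of_dependsOn n fun _ _ h => pos_congr fun i hi => rk_eq_of_edge (h i hi)

lemma measurable_rk (n : ℕ) : Measurable fun x : Path a ha => rk x n :=
  (continuous_rk n).measurable

lemma measurable_vert (n : ℕ) : Measurable fun x : Path a ha => vert x n :=
  (continuous_vert n).measurable

lemma measurable_pos (n : ℕ) : Measurable fun x : Path a ha => pos x n :=
  (continuous_pos n).measurable

variable {ν : Measure (Path a ha)}

/-- All positions at level `n` have the same probability. -/
lemma measure_pos_eq [IsProbabilityMeasure ν] (hν : MeasurePreserving succPath ν ν) {n k : ℕ}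
    (hk : k < towerHeight a n) :
    ν {x | pos x n = k} = (towerHeight a n : ENNReal)⁻¹ := by
  have hmeas (k : ℕ) : MeasurableSet {x : Path a ha | pos x n = k} :=
    measurable_pos n (measurableSet_singleton k)
  have h0 : ∀ k, k < towerHeight a n → ν {x | pos x n = k} = ν {x | pos x n = 0} := by
    intro k hk
    induction k with
    | zero => rfl
    | succ k ih =>
      rw [← ih (by omega), ← hν.measure_preimage (hmeas _).nullMeasurableSet]
      congr 1
      ext x
      change pos (succPath x) n = k + 1 ↔ pos x n = k
      by_cases hM : MaxBelow x n
      · have := pos_add_one_eq_iff.2 hM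
        rw [pos_succPath_of_max hM]
        omega
      · rw [pos_succPath_of_not hM]
        omega
  have hsum : ∑ k ∈ Finset.range (towerHeight a n), ν {x | pos x n = k} = 1 := by
    rw [← measure_biUnion_finset (fun i _ j _ hij => ?_) fun i _ => hmeas i]
    · rw [← measure_univ (μ := ν)]
      congr 1
      ext x
      simp [pos_lt x n]
    · exact Set.disjoint_left.2 fun x hx hx' => hij (hx.symm.trans hx')
  rw [Finset.sum_congr rfl fun k hk => h0 k (Finset.mem_range.1 hk), Finset.sum_const,
    Finset.card_range, nsmul_eq_mul] at hsum
  rw [h0 k hk]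
  exact (ENNReal.eq_inv_of_mul_eq_one_left (by rwa [mul_comm]))

/-- Given the vertex of level `n + 1`, all ranks at level `n` have the same probability. -/
lemma measure_vert_rk_eq (hν : MeasurePreserving succPath ν ν) {n w j : ℕ} (hj : j < a n + n) :
    ν {x | vert x (n + 1) = w ∧ rk x n = j} =
      ν {x | vert x (n + 1) = w} * ((a n + n : ℕ) : ENNReal)⁻¹ := by
  have hmeas (j : ℕ) : MeasurableSet {x : Path a ha | vert x (n + 1) = w ∧ rk x n = j} :=
    (measurable_vert (n + 1) (measurableSet_singleton w)).inter
      (measurable_rk n (measurableSet_singleton j))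
  have h0 : ∀ j, j < a n + n → ν {x | vert x (n + 1) = w ∧ rk x n = j} =
      ν {x | vert x (n + 1) = w ∧ rk x n = 0} := by
    intro j hj
    induction j with
    | zero => rfl
    | succ j ih =>
      rw [← ih (by omega), ← (hν.iterate (towerHeight a n)).measure_preimage
        (hmeas _).nullMeasurableSet]
      congr 1
      ext x
      change vert (succPath^[towerHeight a n] x) (n + 1) = w ∧
        rk (succPath^[towerHeight a n] x) n = j + 1 ↔ vert x (n + 1) = w ∧ rk x n = j
      have hx := pos_lt x n
      have hx' := rk_lt x n
      by_cases hlast : rk x n + 1 < a n + n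
      · have h := iterate_mul_towerHeight (x := x) (n := n) (j := 1) hlast
        rw [one_mul] at h
        rw [h.2.1, (h.2.2 _ (by omega)).1]
        omega
      · -- From the last rank the orbit moves to rank `0`, so `x` is in neither of the two sets.
        have hrk : rk (succPath^[towerHeight a n] x) n = 0 := by
          have hH : towerHeight a (n + 1) = towerHeight a n * rk x n + towerHeight a n := by
            rw [towerHeight_succ, ← Nat.mul_succ]
            congr 1
            omega
          rw [← pos_div, pos_iterate, pos_succ, hH, Nat.mod_eq_sub_mod (by nlinarith),
            show pos x n + rk x n * towerHeight a n + towerHeight a n -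
              (towerHeight a n * rk x n + towerHeight a n) = pos x n by
              rw [mul_comm (rk x n)]; omega, Nat.mod_eq_of_lt (by omega), Nat.div_eq_of_lt hx]
        rw [hrk]
        omega
  have hsum : ∑ j ∈ Finset.range (a n + n), ν {x | vert x (n + 1) = w ∧ rk x n = j} =
      ν {x | vert x (n + 1) = w} := by
    rw [← measure_biUnion_finset (fun i _ j _ hij => ?_) fun i _ => hmeas i]
    · congr 1
      ext x
      simp [rk_lt x n]
    · exact Set.disjoint_left.2 fun x hx hx' => hij (hx.2.symm.trans hx'.2)
  rw [Finset.sum_congr rfl fun j hj => h0 j (Finset.mem_range.1 hj), Finset.sum_const,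
    Finset.card_range, nsmul_eq_mul] at hsum
  rw [h0 j hj, ← hsum, mul_comm, ← mul_assoc, ENNReal.inv_mul_cancel, one_mul]
  · exact_mod_cast (by omega : a n + n ≠ 0)
  · exact ENNReal.natCast_ne_top _

/-- A condition that allows only few ranks into each vertex of level `n + 1` has small
probability. -/
lemma measure_rk_mem_le [IsProbabilityMeasure ν] (hν : MeasurePreserving succPath ν ν) {n c : ℕ}
    (S : ℕ → Finset ℕ) (hS : ∀ w ≤ n + 1, S w ⊆ Finset.range (a n + n))
    (hc : ∀ w ≤ n + 1, (S w).card ≤ c) :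
    ν {x | rk x n ∈ S (vert x (n + 1))} ≤ ENNReal.ofReal (c / (a n + n : ℝ)) := by
  have hq : (0 : ℝ) < a n + n := by exact_mod_cast Nat.add_pos_left (ha n) n
  have hof : ENNReal.ofReal (c / (a n + n : ℝ)) = c * ((a n + n : ℕ) : ENNReal)⁻¹ := by
    rw [ENNReal.ofReal_div_of_pos hq, ENNReal.ofReal_natCast, div_eq_mul_inv]
    congr 2
    rw [← ENNReal.ofReal_natCast]
    push_cast
    rfl
  have hsub : {x : Path a ha | rk x n ∈ S (vert x (n + 1))} ⊆
      ⋃ w ∈ Finset.range (n + 2), ⋃ j ∈ S w, {x | vert x (n + 1) = w ∧ rk x n = j} := by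
    intro x hx
    simp only [mem_iUnion]
    exact ⟨vert x (n + 1), Finset.mem_range.2 (Nat.lt_succ_of_le (vert_le x _)), rk x n, hx,
      rfl, rfl⟩
  have hone : ∑ w ∈ Finset.range (n + 2), ν {x | vert x (n + 1) = w} = 1 := by
    rw [← measure_biUnion_finset (fun i _ j _ hij => ?_)
      fun i _ => show MeasurableSet {x : Path a ha | vert x (n + 1) = i} from
        measurable_vert (n + 1) (measurableSet_singleton i)]
    · rw [← measure_univ (μ := ν)]
      congr 1
      ext x
      have := vert_le x (n + 1)
      simp only [Finset.mem_range, mem_iUnion, mem_univ, iff_true]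
      exact ⟨_, Nat.lt_succ_of_le this, rfl⟩
    · exact Set.disjoint_left.2 fun x hx hx' => hij (hx.symm.trans hx')
  rw [hof]
  calc ν {x | rk x n ∈ S (vert x (n + 1))}
      ≤ ∑ w ∈ Finset.range (n + 2), ∑ j ∈ S w, ν {x | vert x (n + 1) = w ∧ rk x n = j} := by
        refine (measure_mono hsub).trans ((measure_biUnion_finset_le _ _).trans ?_)
        exact Finset.sum_le_sum fun w _ => measure_biUnion_finset_le _ _
    _ ≤ ∑ w ∈ Finset.range (n + 2),
          ν {x | vert x (n + 1) = w} * (c * ((a n + n : ℕ) : ENNReal)⁻¹) := by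
        refine Finset.sum_le_sum fun w hw => ?_
        have hw' : w ≤ n + 1 := Nat.lt_succ_iff.1 (Finset.mem_range.1 hw)
        rw [Finset.sum_congr rfl fun j hj =>
          measure_vert_rk_eq hν (Finset.mem_range.1 (hS w hw' hj)), Finset.sum_const,
          nsmul_eq_mul, mul_left_comm]
        gcongr
        exact hc w hw'
    _ = c * ((a n + n : ℕ) : ENNReal)⁻¹ := by rw [← Finset.sum_mul, hone, one_mul]

/-- The single path whose ranks are all maximal is negligible. -/
lemma measure_forall_maxBelow [IsProbabilityMeasure ν] (h2 : ∀ n, 1 ≤ n → 2 ≤ a n)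
    (hν : MeasurePreserving succPath ν ν) :
    ν {x | ∀ n, MaxBelow x n} = 0 := by
  have hle (n : ℕ) : ν {x | ∀ n, MaxBelow x n} ≤ (towerHeight a n : ENNReal)⁻¹ := by
    have hH := towerHeight_pos ha n
    rw [← measure_pos_eq hν (k := towerHeight a n - 1) (by omega)]
    refine measure_mono fun x hx => ?_
    have := pos_add_one_eq_iff.2 (hx n)
    change pos x n = _
    omega
  have hlim : Tendsto (fun n => (towerHeight a n : ENNReal)⁻¹) atTop (𝓝 0) :=
    ENNReal.tendsto_inv_nat_nhds_zero.comp (tendsto_towerHeight ha h2)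
  exact le_antisymm (ge_of_tendsto' hlim hle) zero_le

lemma summable_rank_bound (h2 : ∀ n, 1 ≤ n → 2 ≤ a n)
    (hsum : Summable fun n : ℕ => (n : ℝ) / (a n : ℝ)) :
    Summable fun n : ℕ => ((n + 2 : ℕ) : ℝ) / (a n + n : ℝ) := by
  rw [← summable_nat_add_iff 1] at hsum ⊢
  refine Summable.of_nonneg_of_le (fun n => by positivity) (fun n => ?_) (hsum.mul_left 3)
  have h1 : (2 : ℝ) ≤ a (n + 1) := by exact_mod_cast h2 (n + 1) (by omega)
  -- After the shift by one, `n + 3 ≤ 3 * (n + 1)`.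
  rw [← mul_div_assoc]
  apply div_le_div₀ <;> push_cast <;> first | positivity | linarith

/-! ### The odometers inside the diagram -/

/-- The vertex of level `n` of the odometer with index `j`, as a natural number. -/
noncomputable def odoVert (j : ℕ∞) (n : ℕ) : ℕ := (odometerVertex j n).1

lemma odoVert_top (n : ℕ) : odoVert ⊤ n = n := by simp [odoVert, odometerVertex]

lemma odoVert_coe (j n : ℕ) : odoVert j n = min j n := by
  have : min (j : ℕ∞) n = ((min j n : ℕ) : ℕ∞) :=
    (Nat.mono_cast (α := ℕ∞)).map_min.symm
  simp only [odoVert, odometerVertex, this, ENat.toNat_natCast]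

lemma odoVert_le (j : ℕ∞) (n : ℕ) : odoVert j n ≤ n := Nat.lt_succ_iff.1 (odometerVertex j n).2

lemma min_odoVert_succ (j : ℕ∞) (n : ℕ) : min (odoVert j (n + 1)) n = odoVert j n := by
  induction j using ENat.recTopCoe with
  | top => simp [odoVert_top]
  | coe j => rw [odoVert_coe, odoVert_coe]; omega

lemma odoVert_eventually_ne {j k : ℕ∞} (h : j ≠ k) : ∀ᶠ n in atTop, odoVert j n ≠ odoVert k n := by
  induction j using ENat.recTopCoe with
  | top =>
    induction k using ENat.recTopCoe with
    | top => exact absurd rfl h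
    | coe k =>
      filter_upwards [eventually_gt_atTop k] with n hn
      rw [odoVert_top, odoVert_coe]
      omega
  | coe j =>
    induction k using ENat.recTopCoe with
    | top =>
      filter_upwards [eventually_gt_atTop j] with n hn
      rw [odoVert_top, odoVert_coe]
      omega
    | coe k =>
      have h' : j ≠ k := fun h' => h (by rw [h'])
      filter_upwards [eventually_gt_atTop j, eventually_gt_atTop k] with n hn hn'
      rw [odoVert_coe, odoVert_coe]
      omega

lemma mem_tailPaths_iff (h2 : ∀ n, 1 ≤ n → 2 ≤ a n) {j : ℕ∞} {x : Path a ha} :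
    x ∈ (countableDiagram a ha).tailPaths (odometerVertex j) ↔
      ∀ᶠ n in atTop, vert x n = odoVert j n := by
  rw [eventually_atTop]
  constructor
  · rintro ⟨y, hy, N, hN⟩
    refine ⟨N, fun n hn => (vert_eq_of_edge (hN n hn)).trans ?_⟩
    exact congrArg Fin.val (hy n)
  · rintro ⟨N, hN⟩
    choose r hr hr' using fun n => exists_sourceAt_eq ha h2 (odoVert j (n + 1)) (odoVert_le j n)
    let y : Path a ha := mkPath (odoVert j) (fun n => if n < N then r n else rk x n) (odoVert_le j)
      (fun n => by split_ifs; exacts [hr n, rk_lt x n])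
      (fun n => by
        split_ifs
        · exact (hr' n).symm
        · rw [← hN n (by omega), ← hN (n + 1) (by omega)]
          exact vert_eq x n)
    refine ⟨y, fun n => Fin.ext (vert_mkPath _ _ _ n), N, fun i hi => ?_⟩
    refine edge_eq_iff.2 ⟨(hN _ (by omega)).trans (vert_mkPath _ _ _ _).symm, ?_⟩
    simp only [y, rk_mkPath, if_neg (not_lt.2 hi)]

/-- The paths that eventually run through the vertices of the odometer with index `j`. -/
def odoPaths (a : ℕ → ℕ) (ha : ∀ n, 0 < a n) (j : ℕ∞) : Set (Path a ha) :=
  {x | ∀ᶠ n in atTop, vert x n = odoVert j n}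

lemma tailPaths_eq (h2 : ∀ n, 1 ≤ n → 2 ≤ a n) (j : ℕ∞) :
    (countableDiagram a ha).tailPaths (odometerVertex j) = odoPaths a ha j :=
  Set.ext fun _ => mem_tailPaths_iff h2

lemma measurableSet_odoPaths (j : ℕ∞) : MeasurableSet (odoPaths a ha j) := by
  have : odoPaths a ha j =
      ⋃ N, ⋂ n, ⋂ (_ : N ≤ n), (fun x : Path a ha => vert x n) ⁻¹' {odoVert j n} := by
    ext x
    simp [odoPaths, eventually_atTop]
  rw [this]
  exact .iUnion fun N => .iInter fun n => .iInter fun _ =>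
    measurable_vert n (measurableSet_singleton _)

lemma disjoint_odoPaths {j k : ℕ∞} (h : j ≠ k) :
    Disjoint (odoPaths a ha j) (odoPaths a ha k) := by
  refine Set.disjoint_left.2 fun x hx hx' => ?_
  obtain ⟨n, h1, h3, h4⟩ := (hx.and (hx'.and (odoVert_eventually_ne h))).exists
  exact h4 (h1.symm.trans h3)

/-- The vertices of a path in `odoPaths a ha j` are known from some level on, and the ranks
determine the vertices below. -/
lemma eq_of_mem_odoPaths {j : ℕ∞} {x y : Path a ha} (hx : x ∈ odoPaths a ha j)
    (hy : y ∈ odoPaths a ha j) (h : rk x = rk y) : x = y := by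
  obtain ⟨N, hN⟩ := eventually_atTop.1 (hx.and hy)
  refine path_ext (fun n => ?_) fun n => congrFun h n
  obtain ⟨h1, h3⟩ := hN (N + n + 1) (by omega)
  exact vert_eq_of_le (h1.trans h3.symm) (fun i _ => congrFun h i) (by omega)

/-- A sequence of vertices with this recursion stays constant once it has left the diagonal. -/
lemma exists_mem_odoPaths {x : Path a ha} (hx : ∀ᶠ n in atTop, vert x n = min (vert x (n + 1)) n) :
    ∃ j, x ∈ odoPaths a ha j := by
  obtain ⟨N, hN⟩ := eventually_atTop.1 hx
  by_cases h : ∀ n, N ≤ n → vert x n = n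
  · refine ⟨⊤, eventually_atTop.2 ⟨N, fun n hn => ?_⟩⟩
    rw [odoVert_top, h n hn]
  · push Not at h
    obtain ⟨m, hm, hne⟩ := h
    have hlt := lt_of_le_of_ne (vert_le x m) hne
    have key (k : ℕ) : vert x (m + k) = vert x m := by
      induction k with
      | zero => rfl
      | succ k ih =>
        have := hN (m + k) (by omega)
        rw [← add_assoc]
        omega
    refine ⟨vert x m, eventually_atTop.2 ⟨m, fun n hn => ?_⟩⟩
    obtain ⟨k, rfl⟩ := Nat.exists_eq_add_of_le hn
    rw [odoVert_coe, key]
    omega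

/-- The maximal path is an exception: it belongs to `odoPaths a ha ⊤`, and its image, the minimal
path, to `odoPaths a ha 0`. -/
lemma succPath_mem_odoPaths_iff {x : Path a ha} (hx : ¬ ∀ n, MaxBelow x n) (j : ℕ∞) :
    succPath x ∈ odoPaths a ha j ↔ x ∈ odoPaths a ha j := by
  push Not at hx
  obtain ⟨N, hN⟩ := hx
  refine eventually_congr (eventually_atTop.2 ⟨N, fun n hn => ?_⟩)
  rw [vert_succPath, succVert_of_not fun h => hN fun i hi => h i (by omega)]

lemma rk_succPath_congr {x y : Path a ha} (h : rk x = rk y) :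
    rk (succPath x) = rk (succPath y) := by
  classical
  have hM (n : ℕ) : MaxBelow x n ↔ MaxBelow y n :=
    forall₂_congr fun i _ => by rw [congrFun h i]
  ext n
  rw [rk_succPath, rk_succPath, succRk, succRk, congrFun h n]
  exact if_congr (hM _) rfl (if_congr (hM _) rfl rfl)

lemma rk_predPath_congr (h2 : ∀ n, 1 ≤ n → 2 ≤ a n) {x y : Path a ha} (h : rk x = rk y) :
    rk (predPath h2 x) = rk (predPath h2 y) := by
  classical
  have hM (n : ℕ) : MinBelow x n ↔ MinBelow y n :=
    forall₂_congr fun i _ => by rw [congrFun h i]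
  ext n
  rw [rk_predPath, rk_predPath, predRk, predRk, congrFun h n]
  exact if_congr (hM _) rfl (if_congr (hM _) rfl rfl)

/-- The ranks into `w` whose source is not the continuation of the odometer through `w`. -/
def strayRanks (a : ℕ → ℕ) (n w : ℕ) : Finset ℕ :=
  {j ∈ Finset.range (a n + n) | sourceAt a n w j ≠ min w n}

lemma card_strayRanks_le {n w : ℕ} (hw : w ≤ n + 1) : (strayRanks a n w).card ≤ n + 2 := by
  have hsub : strayRanks a n w ⊆ Finset.range (min w n + 1) ∪ Finset.Ico (w + a n) (a n + n) := by
    intro j hj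
    simp only [strayRanks, Finset.mem_filter, Finset.mem_range] at hj
    simp only [Finset.mem_union, Finset.mem_range, Finset.mem_Ico]
    obtain ⟨h1, h3⟩ := hj
    unfold sourceAt at h3
    split_ifs at h3 <;> omega
  refine (Finset.card_le_card hsub).trans ((Finset.card_union_le _ _).trans ?_)
  rw [Finset.card_range, Nat.card_Ico]
  omega

/-- The ranks into `w` that are last, or that are followed by an edge with another source. -/
def turningRanks (a : ℕ → ℕ) (n w : ℕ) : Finset ℕ :=
  {j ∈ Finset.range (a n + n) | j + 1 = a n + n ∨ sourceAt a n w j ≠ sourceAt a n w (j + 1)}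

lemma card_turningRanks_le {n w : ℕ} (h0 : 0 < a n) (hw : w ≤ n + 1) :
    (turningRanks a n w).card ≤ n + 2 := by
  have hsub : turningRanks a n w ⊆
      insert (a n + n - 1)
        (Finset.range (min w n + 1) ∪ Finset.Ico (w + a n - 1) (a n + n - 1)) := by
    intro j hj
    simp only [turningRanks, Finset.mem_filter, Finset.mem_range] at hj
    simp only [Finset.mem_insert, Finset.mem_union, Finset.mem_range, Finset.mem_Ico]
    obtain ⟨h1, h3 | h3⟩ := hj
    · omega
    · unfold sourceAt at h3
      split_ifs at h3 <;> omega
  refine (Finset.card_le_card hsub).trans ((Finset.card_insert_le _ _).trans ?_)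
  refine (Nat.add_le_add_right (Finset.card_union_le _ _) 1).trans ?_
  rw [Finset.card_range, Nat.card_Ico]
  omega

/-! ### Existence of invariant measures -/

/-- The Krylov-Bogolyubov argument: a limit of the uniform distributions on longer and longer orbit
segments is invariant. -/
lemma exists_invariant_measure (a : ℕ → ℕ) (ha : ∀ n, 0 < a n) :
    ∃ ν : Measure (Path a ha), IsProbabilityMeasure ν ∧ MeasurePreserving succPath ν ν := by
  classical
  obtain ⟨x, -⟩ := exists_path_vert_eq (a := a) (ha := ha) (n := 0) (v := 0) le_rfl
  have hmeas : Measurable (succPath : Path a ha → Path a ha) := continuous_succPath.measurable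
  let m (n : ℕ) : Measure (Path a ha) :=
    ((n + 1 : ℕ) : ENNReal)⁻¹ • ∑ k ∈ Finset.range (n + 1), Measure.dirac (succPath^[k] x)
  have hm_apply (n : ℕ) {E : Set (Path a ha)} (hE : MeasurableSet E) :
      m n E = ((n + 1 : ℕ) : ENNReal)⁻¹ *
        ∑ k ∈ Finset.range (n + 1), E.indicator 1 (succPath^[k] x) := by
    simp only [m, Measure.smul_apply, Measure.finsetSum_apply, Measure.dirac_apply' _ hE,
      smul_eq_mul]
  have hprob (n : ℕ) : IsProbabilityMeasure (m n) := ⟨by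
    rw [hm_apply n MeasurableSet.univ]
    simp only [indicator_univ, Pi.one_apply, Finset.sum_const, Finset.card_range, nsmul_eq_mul,
      mul_one]
    exact ENNReal.inv_mul_cancel (by positivity) (ENNReal.natCast_ne_top _)⟩
  let p (n : ℕ) : ProbabilityMeasure (Path a ha) := ⟨m n, hprob n⟩
  -- The space of probability measures is compact, so an ultrafilter provides a limit.
  let ν : ProbabilityMeasure (Path a ha) := (Ultrafilter.map p (hyperfilter ℕ)).lim
  have hlim : Tendsto p (hyperfilter ℕ : Filter ℕ) (𝓝 ν) :=
    (Ultrafilter.map p (hyperfilter ℕ)).le_nhds_lim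
  have hstep (n : ℕ) {E : Set (Path a ha)} (hE : MeasurableSet E) :
      m n (succPath ⁻¹' E) ≤ m n E + ((n + 1 : ℕ) : ENNReal)⁻¹ := by
    rw [hm_apply n (hmeas hE), hm_apply n hE]
    calc _ = ((n + 1 : ℕ) : ENNReal)⁻¹ *
          ∑ k ∈ Finset.range (n + 1), E.indicator 1 (succPath^[k + 1] x) := by
          simp only [Function.iterate_succ_apply']
          rfl
      _ ≤ ((n + 1 : ℕ) : ENNReal)⁻¹ *
          (∑ k ∈ Finset.range (n + 1), E.indicator 1 (succPath^[k] x) + 1) := by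
          gcongr
          have h1 := Finset.sum_range_succ'
            (fun k => E.indicator (1 : Path a ha → ENNReal) (succPath^[k] x)) (n + 1)
          rw [Finset.sum_range_succ] at h1
          refine (le_add_right le_rfl).trans (h1.symm.le.trans ?_)
          gcongr
          exact indicator_le_self' (fun _ _ => zero_le) _
      _ = _ := by rw [mul_add, mul_one]
  have hlim_clopen {E : Set (Path a ha)} (hE : IsClopen E) :
      Tendsto (fun n => m n E) (hyperfilter ℕ : Filter ℕ) (𝓝 ((ν : Measure (Path a ha)) E)) :=
    ProbabilityMeasure.tendsto_measure_of_null_frontier_of_tendsto' hlim (by simp [hE.frontier_eq])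
  have hle {E : Set (Path a ha)} (hE : IsClopen E) :
      (ν : Measure (Path a ha)) (succPath ⁻¹' E) ≤ (ν : Measure (Path a ha)) E := by
    have h1 : Tendsto (fun n : ℕ => ((n + 1 : ℕ) : ENNReal)⁻¹) (hyperfilter ℕ : Filter ℕ) (𝓝 0) :=
      (ENNReal.tendsto_inv_nat_nhds_zero.comp (tendsto_add_atTop_nat 1)).mono_left
        Nat.hyperfilter_le_atTop
    have h3 := (hlim_clopen hE).add h1
    rw [add_zero] at h3
    exact le_of_tendsto_of_tendsto' (hlim_clopen (hE.preimage continuous_succPath)) h3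
      fun n => hstep n hE.2.measurableSet
  have heq {E : Set (Path a ha)} (hE : IsClopen E) :
      (ν : Measure (Path a ha)) (succPath ⁻¹' E) = (ν : Measure (Path a ha)) E := by
    -- The reverse inequality is the same one for the complement.
    refine le_antisymm (hle hE) ?_
    have h1 := hle hE.compl
    rw [preimage_compl, prob_compl_eq_one_sub hE.2.measurableSet,
      prob_compl_eq_one_sub (hmeas hE.2.measurableSet)] at h1
    exact (ENNReal.sub_le_sub_iff_left prob_le_one ENNReal.one_ne_top).1 h1
  refine ⟨ν, inferInstance, hmeas, ?_⟩
  have : IsProbabilityMeasure ((ν : Measure (Path a ha)).map succPath) :=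
    Measure.isProbabilityMeasure_map hmeas.aemeasurable
  refine ext_of_generate_finite _ borel_eq_generateFrom_cylinder isPiSystem_cylinder ?_ (by simp)
  rintro _ ⟨y, N, rfl⟩
  rw [Measure.map_apply hmeas (isClopen_cylinder y N).2.measurableSet, heq (isClopen_cylinder y N)]

/-! ### The ergodic measures -/

/-- The Borel-Cantelli lemma for sets of at most `n + 2` ranks into each vertex of level `n + 1`. -/
lemma eventually_rk_notMem [IsProbabilityMeasure ν] (h2 : ∀ n, 1 ≤ n → 2 ≤ a n)
    (hsum : Summable fun n : ℕ => (n : ℝ) / (a n : ℝ)) (hν : MeasurePreserving succPath ν ν)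
    (S : ℕ → ℕ → Finset ℕ) (hS : ∀ n, ∀ w ≤ n + 1, S n w ⊆ Finset.range (a n + n))
    (hc : ∀ n, ∀ w ≤ n + 1, (S n w).card ≤ n + 2) :
    ∀ᵐ x ∂ν, ∀ᶠ n in atTop, rk x n ∉ S n (vert x (n + 1)) := by
  have hfin : ∑' n, ν {x | rk x n ∈ S n (vert x (n + 1))} ≠ ⊤ :=
    ne_top_of_le_ne_top (summable_rank_bound h2 hsum).tsum_ofReal_ne_top
      (ENNReal.tsum_le_tsum fun n => measure_rk_mem_le hν (S n) (hS n) (hc n))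
  have h := measure_setOfPred_frequently_eq_zero hfin
  rw [ae_iff]
  simpa only [not_eventually, not_not] using h

lemma vert_eq_min_of_notMem {x : Path a ha} {n : ℕ}
    (h : rk x n ∉ strayRanks a n (vert x (n + 1))) : vert x n = min (vert x (n + 1)) n := by
  simp only [strayRanks, Finset.mem_filter, Finset.mem_range, rk_lt x n, true_and, not_not] at h
  rw [← h]
  exact vert_eq x n

/-- Almost every path eventually runs through the vertices of one of the odometers: by the
Borel-Cantelli lemma it strays from them only finitely often. -/
lemma ae_exists_mem_odoPaths [IsProbabilityMeasure ν] (h2 : ∀ n, 1 ≤ n → 2 ≤ a n)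
    (hsum : Summable fun n : ℕ => (n : ℝ) / (a n : ℝ)) (hν : MeasurePreserving succPath ν ν) :
    ∀ᵐ x ∂ν, ∃ j, x ∈ odoPaths a ha j := by
  filter_upwards [eventually_rk_notMem h2 hsum hν (strayRanks a)
    (fun n w _ => Finset.filter_subset _ _) fun n w hw => card_strayRanks_le hw] with x hx
  exact exists_mem_odoPaths (hx.mono fun n h => vert_eq_min_of_notMem h)

lemma measurable_rkSeq : Measurable (rk : Path a ha → ℕ → ℕ) := measurable_pi_iff.2 measurable_rk

/-- All invariant probability measures project to the same measure on the sequences of ranks. -/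
lemma map_rk_eq {ν' : Measure (Path a ha)} [IsProbabilityMeasure ν] [IsProbabilityMeasure ν']
    (hν : MeasurePreserving succPath ν ν) (hν' : MeasurePreserving succPath ν' ν') :
    ν.map rk = ν'.map rk := by
  have h1 : IsProbabilityMeasure (ν.map rk) :=
    Measure.isProbabilityMeasure_map measurable_rkSeq.aemeasurable
  have h3 : IsProbabilityMeasure (ν'.map rk) :=
    Measure.isProbabilityMeasure_map measurable_rkSeq.aemeasurable
  refine ext_of_generate_finite {s | ∃ (z : ℕ → ℕ) (N : ℕ), s = PiNat.cylinder z N} ?_ ?_ ?_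
    (by simp)
  · rw [← (PiNat.isTopologicalBasis_cylinders fun _ : ℕ => ℕ).borel_eq_generateFrom]
    exact BorelSpace.measurable_eq
  · rintro _ ⟨x, N, rfl⟩ _ ⟨y, M, rfl⟩ ⟨z, hz, hz'⟩
    refine ⟨z, max N M, ?_⟩
    rw [PiNat.mem_cylinder_iff_eq] at hz hz'
    rw [← hz, ← hz']
    ext u
    simp only [mem_inter_iff, PiNat.mem_cylinder_iff, lt_max_iff]
    exact ⟨fun h i hi => hi.elim (h.1 i) (h.2 i), fun h => ⟨fun i hi => h i (.inl hi),
      fun i hi => h i (.inr hi)⟩⟩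
  · rintro _ ⟨z, N, rfl⟩
    have hm : MeasurableSet (PiNat.cylinder z N) := (PiNat.isOpen_cylinder _ z N).measurableSet
    rw [Measure.map_apply measurable_rkSeq hm, Measure.map_apply measurable_rkSeq hm]
    by_cases hz : ∃ x : Path a ha, ∀ i < N, rk x i = z i
    · obtain ⟨x, hx⟩ := hz
      have : (rk : Path a ha → ℕ → ℕ) ⁻¹' PiNat.cylinder z N = {y | pos y N = pos x N} := by
        ext y
        simp only [mem_preimage, PiNat.mem_cylinder_iff, mem_ofPred_eq]
        exact ⟨fun h => pos_congr fun i hi => by rw [h i hi, hx i hi],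
          fun h i hi => by rw [rk_eq_of_pos_eq h i hi, hx i hi]⟩
      rw [this, measure_pos_eq hν (pos_lt x N), measure_pos_eq hν' (pos_lt x N)]
    · -- Digits out of range are not the ranks of a path.
      have : (rk : Path a ha → ℕ → ℕ) ⁻¹' PiNat.cylinder z N = ∅ :=
        eq_empty_of_forall_notMem fun y hy => hz ⟨y, hy⟩
      rw [this, measure_empty, measure_empty]

/-- The ranks are injective on `odoPaths a ha j`, so the Lusin-Souslin theorem applies. -/
lemma measurableSet_rk_image {A : Set (Path a ha)} (hA : MeasurableSet A) (j : ℕ∞) :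
    MeasurableSet (rk '' (A ∩ odoPaths a ha j)) :=
  (hA.inter (measurableSet_odoPaths j)).image_of_measurable_injOn measurable_rkSeq
    fun _ hx _ hy h => eq_of_mem_odoPaths hx.2 hy.2 h

/-- A measure carried by `odoPaths a ha j` is determined by its projection to the ranks. -/
lemma measure_eq_map_rk [IsProbabilityMeasure ν] {j : ℕ∞} (hj : ν (odoPaths a ha j) = 1)
    {A : Set (Path a ha)} (hA : MeasurableSet A) :
    ν A = ν.map rk (rk '' (A ∩ odoPaths a ha j)) := by
  rw [Measure.map_apply measurable_rkSeq (measurableSet_rk_image hA j)]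
  have hae : ∀ᵐ x ∂ν, x ∈ odoPaths a ha j :=
    (prob_compl_eq_zero_iff (measurableSet_odoPaths j)).2 hj
  refine measure_congr ?_
  filter_upwards [hae] with x hx
  refine propext ⟨fun h => ⟨x, ⟨h, hx⟩, rfl⟩, ?_⟩
  rintro ⟨y, ⟨hy, hy'⟩, h⟩
  rwa [← eq_of_mem_odoPaths hy' hx h]

/-- There is at most one invariant probability measure carried by `odoPaths a ha j`. -/
lemma eq_of_odoPaths {ν' : Measure (Path a ha)} [IsProbabilityMeasure ν] [IsProbabilityMeasure ν']
    (hν : MeasurePreserving succPath ν ν) (hν' : MeasurePreserving succPath ν' ν') {j : ℕ∞}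
    (hj : ν (odoPaths a ha j) = 1) (hj' : ν' (odoPaths a ha j) = 1) : ν = ν' := by
  ext A hA
  rw [measure_eq_map_rk hj hA, measure_eq_map_rk hj' hA, map_rk_eq hν hν']

/-- Almost every sequence of ranks is realized by a path in `odoPaths a ha j`: by the Borel-Cantelli
lemma, from some level on its edges into the vertices of the odometer continue the odometer. -/
lemma ae_exists_rk_eq [IsProbabilityMeasure ν] (h2 : ∀ n, 1 ≤ n → 2 ≤ a n)
    (hsum : Summable fun n : ℕ => (n : ℝ) / (a n : ℝ)) (hν : MeasurePreserving succPath ν ν)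
    (j : ℕ∞) : ∀ᵐ x ∂ν, ∃ t ∈ odoPaths a ha j, rk t = rk x := by
  filter_upwards [eventually_rk_notMem h2 hsum hν (fun n _ => strayRanks a n (odoVert j (n + 1)))
    (fun n w _ => Finset.filter_subset _ _)
    fun n w _ => card_strayRanks_le (odoVert_le j (n + 1))] with x hx
  obtain ⟨N, hN⟩ := eventually_atTop.1 hx
  obtain ⟨t, ht, ht'⟩ := exists_path_of_tail (ha := ha) N (w := odoVert j) (r := rk x)
    (fun n _ => odoVert_le j n) (rk_lt x) (fun n hn => by
      have := hN n hn
      simp only [strayRanks, Finset.mem_filter, Finset.mem_range, rk_lt x n, true_and, not_not]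
        at this
      rw [this, min_odoVert_succ])
  exact ⟨t, eventually_atTop.2 ⟨N, ht'⟩, funext ht⟩

/-- The measure on `odoPaths a ha j` that corresponds to the measure `ν` under the projection to the
ranks, which is injective on this set. -/
noncomputable def odoMeasure (ν : Measure (Path a ha)) (j : ℕ∞) : Measure (Path a ha) :=
  ((ν.map rk).comap fun t : odoPaths a ha j => rk t.1).map Subtype.val

lemma odoMeasure_apply (j : ℕ∞) {A : Set (Path a ha)} (hA : MeasurableSet A) :
    odoMeasure ν j A = ν {x | ∃ t ∈ A ∩ odoPaths a ha j, rk t = rk x} := by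
  have himage (s : Set (odoPaths a ha j)) :
      (fun t : odoPaths a ha j => rk t.1) '' s = rk '' (Subtype.val '' s ∩ odoPaths a ha j) := by
    rw [inter_eq_left.2 (by rintro _ ⟨t, -, rfl⟩; exact t.2), image_image]
  rw [odoMeasure, Measure.map_apply measurable_subtype_coe hA, Measure.comap_apply, himage,
    Subtype.image_preimage_coe, inter_comm, ← inter_assoc, inter_self,
    inter_comm, Measure.map_apply measurable_rkSeq (measurableSet_rk_image hA j)]
  · rfl
  · exact fun x y h => Subtype.ext (eq_of_mem_odoPaths x.2 y.2 h)
  · intro s hs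
    rw [himage]
    exact measurableSet_rk_image ((measurableSet_odoPaths j).subtype_image hs) j
  · exact measurable_subtype_coe hA

lemma odoMeasure_odoPaths [IsProbabilityMeasure ν] (h2 : ∀ n, 1 ≤ n → 2 ≤ a n)
    (hsum : Summable fun n : ℕ => (n : ℝ) / (a n : ℝ)) (hν : MeasurePreserving succPath ν ν)
    (j : ℕ∞) : odoMeasure ν j (odoPaths a ha j) = 1 := by
  rw [odoMeasure_apply j (measurableSet_odoPaths j), inter_self,
    measure_congr (eventuallyEq_univ.2 (ae_exists_rk_eq h2 hsum hν j)), measure_univ]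

lemma isProbabilityMeasure_odoMeasure [IsProbabilityMeasure ν] (h2 : ∀ n, 1 ≤ n → 2 ≤ a n)
    (hsum : Summable fun n : ℕ => (n : ℝ) / (a n : ℝ)) (hν : MeasurePreserving succPath ν ν)
    (j : ℕ∞) : IsProbabilityMeasure (odoMeasure ν j) := by
  refine ⟨?_⟩
  rw [← odoMeasure_odoPaths h2 hsum hν j, odoMeasure_apply j .univ,
    odoMeasure_apply j (measurableSet_odoPaths j), univ_inter, inter_self]

lemma measurePreserving_odoMeasure [IsProbabilityMeasure ν] (h2 : ∀ n, 1 ≤ n → 2 ≤ a n)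
    (hν : MeasurePreserving succPath ν ν) (j : ℕ∞) :
    MeasurePreserving succPath (odoMeasure ν j) (odoMeasure ν j) := by
  have hmeas : Measurable (succPath : Path a ha → Path a ha) := continuous_succPath.measurable
  refine ⟨hmeas, ?_⟩
  ext A hA
  have hset : MeasurableSet {x : Path a ha | ∃ t ∈ A ∩ odoPaths a ha j, rk t = rk x} :=
    measurable_rkSeq (measurableSet_rk_image hA j)
  rw [Measure.map_apply hmeas hA, odoMeasure_apply j (hmeas hA), odoMeasure_apply j hA,
    ← hν.measure_preimage hset.nullMeasurableSet]
  have hae : ∀ᵐ x ∂ν, ¬ ∀ n, MaxBelow x n := by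
    rw [ae_iff]
    simpa only [not_not] using measure_forall_maxBelow h2 hν
  have hmax {x y : Path a ha} (h : rk x = rk y) (hx : ¬ ∀ n, MaxBelow x n) :
      ¬ ∀ n, MaxBelow y n := fun hy => hx fun n i hi => by rw [congrFun h i]; exact hy n i hi
  refine measure_congr ?_
  filter_upwards [hae] with x hx
  refine propext ⟨?_, ?_⟩
  · rintro ⟨t, ⟨htA, htj⟩, ht⟩
    exact ⟨succPath t, ⟨htA, (succPath_mem_odoPaths_iff (hmax ht.symm hx) j).2 htj⟩,
      rk_succPath_congr ht⟩
  · rintro ⟨t, ⟨htA, htj⟩, ht⟩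
    have hr : rk (predPath h2 t) = rk x := by
      rw [rk_predPath_congr h2 ht, predPath_succPath]
    refine ⟨predPath h2 t, ⟨?_, ?_⟩, hr⟩
    · change succPath (predPath h2 t) ∈ A
      rwa [succPath_predPath]
    · rwa [← succPath_mem_odoPaths_iff (hmax hr.symm hx), succPath_predPath]

/-- The invariant probability measure carried by `odoPaths a ha j` is ergodic: conditioned on an
invariant set of positive measure it is another such measure, hence the same one. -/
lemma ergodic_of_odoPaths [IsProbabilityMeasure ν] (hν : MeasurePreserving succPath ν ν) {j : ℕ∞}
    (hj : ν (odoPaths a ha j) = 1) : Ergodic succPath ν := by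
  refine ⟨hν, ⟨fun s hs hsinv => ?_⟩⟩
  rw [eventuallyConst_set', ae_eq_empty, ae_eq_univ]
  by_cases h0 : ν s = 0
  · exact Or.inl h0
  refine Or.inr ?_
  have hcond : IsProbabilityMeasure (ProbabilityTheory.cond ν s) :=
    ProbabilityTheory.cond_isProbabilityMeasure h0
  have hinv : MeasurePreserving succPath (ProbabilityTheory.cond ν s)
      (ProbabilityTheory.cond ν s) := by
    have h1 := hν.restrict_preimage hs
    rw [hsinv] at h1
    exact h1.smul_measure _
  have hcj : ProbabilityTheory.cond ν s (odoPaths a ha j) = 1 := by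
    rw [← prob_compl_eq_zero_iff (measurableSet_odoPaths j)] at hj ⊢
    exact ProbabilityTheory.cond_absolutelyContinuous hj
  have heq := eq_of_odoPaths hinv hν hcj hj
  rw [← heq, ProbabilityTheory.cond_apply hs, inter_compl_self, measure_empty, mul_zero]

/-- The sets `odoPaths a ha j` are invariant up to null sets, so they have measure zero or one under
an ergodic measure, and countably many null sets cannot cover almost all paths. -/
lemma exists_odoPaths_of_ergodic [IsProbabilityMeasure ν] (h2 : ∀ n, 1 ≤ n → 2 ≤ a n)
    (hsum : Summable fun n : ℕ => (n : ℝ) / (a n : ℝ)) (hν : Ergodic succPath ν) :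
    ∃ j, ν (odoPaths a ha j) = 1 := by
  by_contra! h
  have hae : ∀ᵐ x ∂ν, ¬ ∀ n, MaxBelow x n := by
    rw [ae_iff]
    simpa only [not_not] using measure_forall_maxBelow h2 hν.toMeasurePreserving
  have hnull (j : ℕ∞) : ∀ᵐ x ∂ν, x ∉ odoPaths a ha j := by
    have hinv : succPath ⁻¹' odoPaths a ha j =ᵐ[ν] odoPaths a ha j := by
      filter_upwards [hae] with x hx
      exact propext (succPath_mem_odoPaths_iff hx j)
    rcases hν.quasiErgodic.ae_empty_or_univ₀ (measurableSet_odoPaths j).nullMeasurableSet hinv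
      with h0 | h1
    · filter_upwards [h0] with x hx hx'
      exact (hx.mp hx' : x ∈ (∅ : Set _))
    · refine absurd ?_ (h j)
      rw [measure_congr h1, measure_univ]
  have hfalse : ∀ᵐ x ∂ν, False := by
    filter_upwards [ae_exists_mem_odoPaths h2 hsum hν.toMeasurePreserving, ae_all_iff.2 hnull]
      with x hx hx'
    obtain ⟨j, hj⟩ := hx
    exact hx' j hj
  rw [eventually_false_iff_eq_bot, ae_eq_bot] at hfalse
  exact IsProbabilityMeasure.ne_zero ν hfalse

lemma exists_ergodic_family (h2 : ∀ n, 1 ≤ n → 2 ≤ a n)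
    (hsum : Summable fun n : ℕ => (n : ℝ) / (a n : ℝ)) :
    ∃ μ : ℕ∞ → Measure (Path a ha),
      Function.Injective μ ∧ range μ = {ν | IsProbabilityMeasure ν ∧ Ergodic succPath ν} ∧
      ∀ (j : ℕ∞) (ν : Measure (Path a ha)), IsProbabilityMeasure ν →
        MeasurePreserving succPath ν ν → (ν (odoPaths a ha j) = 1 ↔ ν = μ j) := by
  obtain ⟨ν₀, hν₀, hinv⟩ := exists_invariant_measure a ha
  have hprob := isProbabilityMeasure_odoMeasure h2 hsum hinv
  have hpres := measurePreserving_odoMeasure h2 hinv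
  have hmass := odoMeasure_odoPaths h2 hsum hinv
  refine ⟨odoMeasure ν₀, fun j k hjk => ?_, ?_, fun j ν hν hνinv => ⟨fun h => ?_, ?_⟩⟩
  · by_contra hne
    have h1 := (prob_compl_eq_zero_iff (measurableSet_odoPaths j)).2 (hmass j)
    rw [hjk] at h1
    have h3 := measure_mono_null (disjoint_odoPaths (a := a) (ha := ha) hne).subset_compl_left h1
    rw [hmass k] at h3
    exact one_ne_zero h3
  · ext ν
    constructor
    · rintro ⟨j, rfl⟩
      exact ⟨hprob j, ergodic_of_odoPaths (hpres j) (hmass j)⟩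
    · rintro ⟨hν, herg⟩
      obtain ⟨j, hj⟩ := exists_odoPaths_of_ergodic h2 hsum herg
      exact ⟨j, eq_of_odoPaths (hpres j) herg.toMeasurePreserving (hmass j) hj⟩
  · exact eq_of_odoPaths hνinv (hpres j) h (hmass j)
  · rintro rfl
    exact hmass j

/-! ### Rigidity -/

/-- Moving on by the height of level `n` increases the rank by one, unless it is the last one. -/
lemma setOf_vert_iterate_ne_subset (n : ℕ) :
    {x : Path a ha | vert (succPath^[towerHeight a n] x) n ≠ vert x n} ⊆
      {x | rk x n ∈ turningRanks a n (vert x (n + 1))} := by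
  intro x hx
  have hlt := rk_lt x n
  simp only [mem_ofPred_eq, turningRanks, Finset.mem_filter, Finset.mem_range, hlt, true_and]
  by_contra! h
  refine hx ?_
  have h1 := iterate_mul_towerHeight (x := x) (n := n) (j := 1) (by omega)
  rw [one_mul] at h1
  rw [vert_eq, vert_eq x, h1.2.1, (h1.2.2 _ (by omega)).1, h.2]

lemma measure_cylinder_symmDiff_le [IsProbabilityMeasure ν] (hν : MeasurePreserving succPath ν ν)
    (x : Path a ha) {N n : ℕ} (hn : N ≤ n) :
    ν ((succPath^[towerHeight a n] ⁻¹' cylinder x N) ∆ cylinder x N) ≤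
      ENNReal.ofReal (((n + 2 : ℕ) : ℝ) / (a n + n : ℝ)) := by
  refine (measure_mono ?_).trans (measure_rk_mem_le hν (turningRanks a n)
    (fun w _ => Finset.filter_subset _ _) fun w hw => card_turningRanks_le (ha n) hw)
  refine Subset.trans (fun y hy => ?_) (setOf_vert_iterate_ne_subset n)
  intro hv
  have hp : pos (succPath^[towerHeight a n] y) n = pos y n := by
    rw [pos_iterate, Nat.add_mod_right, Nat.mod_eq_of_lt (pos_lt y n)]
  have hedge := edge_eq_of_pos_eq hv hp
  have hiff : succPath^[towerHeight a n] y ∈ cylinder x N ↔ y ∈ cylinder x N :=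
    forall₂_congr fun i hi => by rw [hedge i (by omega)]
  rcases hy with ⟨h1, h3⟩ | ⟨h1, h3⟩
  · exact h3 (hiff.1 h1)
  · exact h3 (hiff.2 h1)

/-- The bound on cylinders carries over to all Borel sets, since the sets along which the measure of
the symmetric difference tends to zero are closed under complements and disjoint unions. -/
lemma isRigidAlong_towerHeight [IsProbabilityMeasure ν] (h2 : ∀ n, 1 ≤ n → 2 ≤ a n)
    (hsum : Summable fun n : ℕ => (n : ℝ) / (a n : ℝ)) (hν : MeasurePreserving succPath ν ν) :
    IsRigidAlong succPath ν (towerHeight a) := by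
  refine ⟨tendsto_towerHeight ha h2, fun A hA => ?_⟩
  have hit (n : ℕ) := hν.iterate (towerHeight a n)
  induction A, hA using MeasurableSpace.induction_on_inter borel_eq_generateFrom_cylinder
    isPiSystem_cylinder with
  | empty => simp
  | basic A hA =>
    obtain ⟨x, N, rfl⟩ := hA
    have hlim := ENNReal.tendsto_ofReal (summable_rank_bound h2 hsum).tendsto_atTop_zero
    rw [ENNReal.ofReal_zero] at hlim
    exact tendsto_of_tendsto_of_tendsto_of_le_of_le' tendsto_const_nhds hlim
      (Eventually.of_forall fun _ => zero_le)
      (eventually_atTop.2 ⟨N, fun n hn => measure_cylinder_symmDiff_le hν x hn⟩)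
  | compl A hA ih =>
    refine ih.congr fun n => ?_
    rw [preimage_compl, compl_symmDiff_compl]
  | iUnion f hd hf ih =>
    have hmeasure (n : ℕ) (i : ℕ) : ν (succPath^[towerHeight a n] ⁻¹' f i) = ν (f i) :=
      (hit n).measure_preimage (hf i).nullMeasurableSet
    have hbound : ∑' i, 2 * ν (f i) ≠ ⊤ := by
      rw [ENNReal.tsum_mul_left, ← measure_iUnion hd hf]
      exact ENNReal.mul_ne_top (by simp) (measure_ne_top _ _)
    -- Dominated convergence for the counting measure.
    have hlim : Tendsto (fun n => ∑' i, ν ((succPath^[towerHeight a n] ⁻¹' f i) ∆ f i)) atTop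
        (𝓝 (∑' _ : ℕ, 0)) := by
      simp only [← lintegral_count] at hbound ⊢
      refine tendsto_lintegral_of_dominated_convergence (fun i => 2 * ν (f i))
        (fun n => measurable_from_top) (fun n => Eventually.of_forall fun i => ?_) hbound
        (Eventually.of_forall ih)
      dsimp only
      rw [two_mul]
      nth_rw 1 [← hmeasure n i]
      exact (measure_mono symmDiff_subset_union).trans (measure_union_le _ _)
    rw [tsum_zero] at hlim
    refine tendsto_of_tendsto_of_tendsto_of_le_of_le tendsto_const_nhds hlim
      (fun _ => zero_le) fun n => ?_
    refine (measure_mono ?_).trans (measure_iUnion_le _)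
    rw [preimage_iUnion]
    exact iUnion_symmDiff_iUnion_subset

end CountableDiagram

/-! ### The properties of the diagram and of its Vershik map -/

theorem mainTheorem8 (a : ℕ → ℕ) (ha : ∀ n, 0 < a n) (ha' : ∀ n, 1 ≤ n → 2 ≤ a n)
    (hsum : Summable fun n : ℕ => (n : ℝ) / (a n : ℝ)) :
    (countableDiagram a ha).IsConsecutive ∧
    (∃! x, x ∈ (countableDiagram a ha).minPaths) ∧
    (∃! x, x ∈ (countableDiagram a ha).maxPaths) ∧
    (∀ (n : ℕ) (v : (countableDiagram a ha).V n),
      (countableDiagram a ha).height n v = ∏ i ∈ Finset.range n, (a i + i)) ∧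
    ∃ φ : (countableDiagram a ha).PathSpace ≃ₜ (countableDiagram a ha).PathSpace,
      -- `φ` is the Vershik map
      (countableDiagram a ha).IsVershikMap φ ∧
      (∀ ψ, (countableDiagram a ha).IsVershikMap ψ → ψ = φ) ∧
      -- minimality
      (∀ x, Dense (range fun k : ℕ => φ^[k] x)) ∧
      -- zero topological entropy
      Dynamics.coverEntropy φ univ = 0 ∧
      -- conjugacy with the `S`-adic subshift of the substitutions read on the diagram,
      -- which is a Toeplitz system
      (∀ c : (n : ℕ) → (countableDiagram a ha).Alphabet n,
        IsToeplitzSystem (sAdicSubshift (countableDiagram a ha).substitution c) ∧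
        ∃ h : (countableDiagram a ha).PathSpace ≃ₜ
            sAdicSubshift (countableDiagram a ha).substitution c,
          ∀ x, (h (φ x) : ℤ → (countableDiagram a ha).Alphabet 0) = leftShift (h x)) ∧
      -- there are countably infinitely many ergodic measures
      {μ : Measure (countableDiagram a ha).PathSpace |
        IsProbabilityMeasure μ ∧ Ergodic φ μ}.Countable ∧
      {μ : Measure (countableDiagram a ha).PathSpace |
        IsProbabilityMeasure μ ∧ Ergodic φ μ}.Infinite ∧
      -- they are the extensions of the measures of the odometers through `odometerVertex j`
      (∃ μ : ℕ∞ → Measure (countableDiagram a ha).PathSpace,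
        Function.Injective μ ∧
        range μ = {ν | IsProbabilityMeasure ν ∧ Ergodic φ ν} ∧
        ∀ (j : ℕ∞) (ν : Measure (countableDiagram a ha).PathSpace),
          IsProbabilityMeasure ν → MeasurePreserving φ ν ν →
            (ν ((countableDiagram a ha).tailPaths (odometerVertex j)) = 1 ↔ ν = μ j)) ∧
      -- every invariant probability measure is rigid along the tower heights
      ∀ ν : Measure (countableDiagram a ha).PathSpace,
        IsProbabilityMeasure ν → MeasurePreserving φ ν ν →
          IsRigidAlong φ ν (fun n => ∏ i ∈ Finset.range n, (a i + i)) := by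
  obtain ⟨μ, hinj, hrange, hμ⟩ := CountableDiagram.exists_ergodic_family (ha := ha) ha' hsum
  refine ⟨CountableDiagram.isConsecutive, CountableDiagram.existsUnique_minPath,
    CountableDiagram.existsUnique_maxPath ha', fun n v => (CountableDiagram.height_eq n v).2,
    CountableDiagram.vershik ha', CountableDiagram.isVershikMap_vershik ha',
    fun ψ hψ => CountableDiagram.eq_vershik ha' hψ, CountableDiagram.dense_orbit ha',
    CountableDiagram.coverEntropy_succPath ha',
    fun c => ⟨CountableDiagram.isToeplitzSystem ha' c, CountableDiagram.exists_conjugacy ha' c⟩,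
    ?_, ?_, ⟨μ, hinj, hrange, ?_⟩,
    fun ν hν hinv => CountableDiagram.isRigidAlong_towerHeight ha' hsum hinv⟩
  · exact (countable_range μ).mono hrange.ge
  · exact (infinite_range_of_injective hinj).mono hrange.le
  · intro j ν hν hinv
    rw [CountableDiagram.tailPaths_eq ha']
    exact hμ j ν hν hinv
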